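/- Write $e(t)=e^{2\pi i t}$, let $\Omega(n)$ be the number of prime factors of $n\ge 1$ counted with multiplicity, and let $\lambda(n)=(-1)^{\Omega(n)}$ be the Liouville function. Let $X$ be a compact metric space and $T\colon X\to X$ a continuous map which is uniquely ergodic, i.e. there is exactly one $T$-invariant Borel probability measure $\mu$ on $X$. Then for every continuous $f\colon X\to\mathbb{C}$, every $x\in X$ and every $\alpha\in\mathbb{R}$, $$\lim_{N\to\infty}\frac1N\sum_{n=1}^N e(n\alpha)\,f\big(T^{\Omega(n)}x\big)=\begin{cases}\int f\,d\mu,&\alpha\in\mathbb{Z},\\ 0,&\alpha\in\mathbb{R}\setminus\mathbb{Z}.\end{cases}$$ Moreover, for every continuous $f\colon X\to\mathbb{C}$, every $x\in X$, every integer $m\ge 1$ and every $r\in\{0,1,\dots,m-1\}$, $$\lim_{N\to\infty}\frac1N\sum_{n=1}^N f\big(T^{\Omega(mn+r)}x\big)=\int f\,d\mu .$$ In particular, for every rational $\alpha$, $$\lim_{N\to\infty}\frac1N\sum_{n=1}^N e(n\alpha)\,\lambda(n)=0,$$ which is a well-known equivalent form of the Prime Number Theorem in arithmetic progressions. -/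

import Mathlib

open MeasureTheory Filter Topology
open scoped ArithmeticFunction.Omega

/-- A self-map `T` of a measurable space `X` is uniquely ergodic if there is exactly one
`T`-invariant probability measure on `X`. -/
def UniquelyErgodic {X : Type*} [MeasurableSpace X] (T : X → X) : Prop :=
  ∃! μ : Measure X, IsProbabilityMeasure μ ∧ MeasurePreserving T μ μ

/-- The additive character `e(t) = exp(2πit)` of the real line. -/
noncomputable def expTwoPiI (t : ℝ) : ℂ :=
  Complex.exp (2 * Real.pi * Complex.I * t)

/-- The Cesàro average `(1/N) ∑_{n=1}^N a(n)`. -/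
noncomputable def cesaroAverage (a : ℕ → ℂ) (N : ℕ) : ℂ :=
  (1 / (N : ℂ)) * ∑ n ∈ Finset.Icc 1 N, a n

/-! ### The Turán–Kubilius inequality for finitely many primes -/

/-! The core is that averages of F₀(n) = w(n) a(Ω(n)) and F₁(n) = w(n) a(Ω(n) + 1) agree
asymptotically when a and w are bounded and w(pn) = w(n) for primes p ≡ 1 mod q
(`tendsto_cesaroAverage_shift_Omega`). For such p, F₀(pn) = F₁(n).

Give finitely many such primes weights c_p in [0, 1] and put L = ∑ c_p/p. By Turán–Kubilius, ∑ c_p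
1_{p ∣ n} is L up to an error of order √L in mean square. On the scale u = log N, dilation by p
becomes translation by log p, so L·A₀(u) is, up to O(√L), the convolution of A₁ with ν = ∑ (c_p/p)
δ_{log p}; here A_k is the average of F_k over [1, e^u]. As L can be arbitrarily large, it remains
to see that A₁ is asymptotically invariant under translations.

This is a Tauberian argument. For suitable weights ν̂(ξ) and its derivative stay bounded on η ≤ |ξ|
≤ R while L → ∞: the Λ-weighted Dirichlet series of the class 1 mod q extends continuously to Re s =
1 apart from its pole at s = 1 (`exists_weighted_primes`). If K has frequencies only in that band, K
* ν is then bounded in L¹ independently of L, and dividing by L gives K * A → 0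
(`tendsto_convolution_logAverage`). So A carries asymptotically only frequencies near 0; since it
also oscillates slowly, it is asymptotically translation invariant
(`tendsto_logAverage_sub_translate`).

Taking a(k) = g(T^k x) and w the indicator of a residue class, the points T^{Ω(mn+r)} x have
asymptotically T-invariant empirical measures, and unique ergodicity identifies the limit. Rational
α follows by splitting into residue classes modulo the denominator. For irrational α no ergodicity
is needed: Turán–Kubilius together with orthogonality of n ↦ e(pnα) for distinct p suffices
(`tendsto_cesaroAverage_irrational`). -/

lemma sum_Icc_ite_dvd (F : ℕ → ℂ) {d : ℕ} (hd : 0 < d) (N : ℕ) :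
    ∑ n ∈ Finset.Icc 1 N, F n * (if d ∣ n then 1 else 0) =
      ∑ n ∈ Finset.Icc 1 (N / d), F (d * n) := by
  simp only [mul_ite, mul_one, mul_zero]
  rw [← Finset.sum_filter]
  symm
  refine Finset.sum_nbij' (fun n => d * n) (fun n => n / d) ?_ ?_ ?_ ?_ ?_
  · intro n hn
    simp only [Finset.mem_Icc, Finset.mem_filter] at hn ⊢
    refine ⟨⟨Nat.mul_pos hd hn.1, ?_⟩, dvd_mul_right _ _⟩
    exact (Nat.mul_le_mul_left d hn.2).trans (Nat.mul_div_le N d)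
  · intro n hn
    simp only [Finset.mem_Icc, Finset.mem_filter] at hn ⊢
    exact ⟨Nat.div_pos (Nat.le_of_dvd hn.1.1 hn.2) hd, Nat.div_le_div_right hn.1.2⟩
  · intro n _
    exact Nat.mul_div_cancel_left n hd
  · intro n hn
    simp only [Finset.mem_filter] at hn
    exact Nat.mul_div_cancel' hn.2
  · intro n _
    rfl

lemma sum_Icc_dvd_indicator {d : ℕ} (N : ℕ) :
    ∑ n ∈ Finset.Icc 1 N, (if d ∣ n then (1 : ℝ) else 0) = ((N / d : ℕ) : ℝ) := by
  rw [Finset.sum_boole, ← Nat.Ioc_filter_dvd_card_eq_div]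
  rfl

/-- For distinct primes, divisibility by p and by q are independent: after expansion the main terms
N/(pq) cancel, and only rounding errors from three floor functions remain, each at most 1. -/
lemma sum_dvd_covariance_le {p q : ℕ} (hp : p.Prime) (hq : q.Prime) (hpq : p ≠ q) (N : ℕ) :
    |∑ n ∈ Finset.Icc 1 N, ((if p ∣ n then (1 : ℝ) else 0) - 1 / p) *
      ((if q ∣ n then (1 : ℝ) else 0) - 1 / q)| ≤ 3 := by
  have key : ∀ n : ℕ, ((if p ∣ n then (1 : ℝ) else 0) - 1 / p) *
      ((if q ∣ n then (1 : ℝ) else 0) - 1 / q) =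
      (if p * q ∣ n then (1 : ℝ) else 0) - (1 / p) * (if q ∣ n then (1 : ℝ) else 0)
        - (1 / q) * (if p ∣ n then (1 : ℝ) else 0) + 1 / p * (1 / q) := by
    intro n
    have h : (p * q ∣ n) ↔ (p ∣ n ∧ q ∣ n) :=
      ⟨fun h => ⟨(dvd_mul_right _ _).trans h, (dvd_mul_left _ _).trans h⟩,
        fun h => ((Nat.coprime_primes hp hq).2 hpq).mul_dvd_of_dvd_of_dvd h.1 h.2⟩
    by_cases h1 : p ∣ n <;> by_cases h2 : q ∣ n <;> simp [h, h1, h2] <;> ring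
  simp_rw [key]
  rw [Finset.sum_add_distrib, Finset.sum_sub_distrib, Finset.sum_sub_distrib, ← Finset.mul_sum,
    ← Finset.mul_sum, sum_Icc_dvd_indicator, sum_Icc_dvd_indicator, sum_Icc_dvd_indicator]
  simp only [Finset.sum_const, Nat.card_Icc, add_tsub_cancel_right, nsmul_eq_mul]
  have hp1 : (1 : ℝ) ≤ p := by exact_mod_cast hp.one_lt.le
  have hq1 : (1 : ℝ) ≤ q := by exact_mod_cast hq.one_lt.le
  have hfl : ∀ d : ℕ, 0 < d → ((N / d : ℕ) : ℝ) ≤ N / d ∧ (N : ℝ) / d - 1 ≤ ((N / d : ℕ) : ℝ) := by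
    intro d hd
    refine ⟨Nat.cast_div_le, ?_⟩
    have := Nat.lt_floor_add_one ((N : ℝ) / d)
    rw [Nat.floor_div_natCast, Nat.floor_natCast] at this
    linarith
  obtain ⟨a1, a2⟩ := hfl _ (Nat.mul_pos hp.pos hq.pos)
  obtain ⟨b1, b2⟩ := hfl _ hp.pos
  obtain ⟨c1, c2⟩ := hfl _ hq.pos
  have ip : (1 : ℝ) / p ≤ 1 := by rw [div_le_one] <;> linarith
  have iq : (1 : ℝ) / q ≤ 1 := by rw [div_le_one] <;> linarith
  have ip0 : (0 : ℝ) ≤ 1 / p := by positivity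
  have iq0 : (0 : ℝ) ≤ 1 / q := by positivity
  push_cast at a1 a2
  have e1 : (N : ℝ) / (p * q) = 1 / p * (N / q) := by field_simp
  have e2 : (N : ℝ) / (p * q) = 1 / q * (N / p) := by field_simp
  have e3 : (N : ℝ) / (p * q) = N * (1 / p * (1 / q)) := by field_simp
  have m1 := mul_le_mul_of_nonneg_left c1 ip0
  have m2 := mul_le_mul_of_nonneg_left c2 ip0
  have m3 := mul_le_mul_of_nonneg_left b1 iq0
  have m4 := mul_le_mul_of_nonneg_left b2 iq0
  rw [mul_sub, ← e1] at m2
  rw [mul_sub, ← e2] at m4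
  rw [← e1] at m1
  rw [← e2] at m3
  rw [← e3, abs_le]
  constructor <;> linarith

lemma sum_dvd_variance_le {p : ℕ} (hp : p.Prime) (N : ℕ) :
    ∑ n ∈ Finset.Icc 1 N, ((if p ∣ n then (1 : ℝ) else 0) - 1 / p) *
      ((if p ∣ n then (1 : ℝ) else 0) - 1 / p) ≤ N / p := by
  have key : ∀ n : ℕ, ((if p ∣ n then (1 : ℝ) else 0) - 1 / p) *
      ((if p ∣ n then (1 : ℝ) else 0) - 1 / p) =
      (1 - 2 / p) * (if p ∣ n then (1 : ℝ) else 0) + 1 / p * (1 / p) := by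
    intro n
    by_cases h1 : p ∣ n <;> simp [h1] <;> ring
  simp_rw [key]
  rw [Finset.sum_add_distrib, ← Finset.mul_sum, sum_Icc_dvd_indicator]
  simp only [Finset.sum_const, Nat.card_Icc, add_tsub_cancel_right, nsmul_eq_mul]
  have hp2 : (2 : ℝ) ≤ p := by exact_mod_cast hp.two_le
  have h1 : (0 : ℝ) ≤ 1 - 2 / p := by
    rw [sub_nonneg, div_le_one] <;> linarith
  have := mul_le_mul_of_nonneg_left (Nat.cast_div_le (α := ℝ) (m := N) (n := p)) h1
  have h3 : (1 - 2 / p) * ((N : ℝ) / p) + N * (1 / p * (1 / p)) = N / p - N * (1 / p * (1 / p)) := by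
    ring
  have h4 : (0 : ℝ) ≤ N * (1 / p * (1 / p)) := by positivity
  linarith

/-- Expand the square: each diagonal term is a variance, at most c_p² N/p ≤ N c_p/p, and each
off-diagonal covariance is at most 3. The error in `B.card` is harmless because B is fixed before N
→ ∞. -/
lemma turanKubilius {B : Finset ℕ} (hB : ∀ p ∈ B, p.Prime) {c : ℕ → ℝ}
    (hc : ∀ p, 0 ≤ c p ∧ c p ≤ 1) (N : ℕ) :
    ∑ n ∈ Finset.Icc 1 N, (∑ p ∈ B, c p * ((if p ∣ n then (1 : ℝ) else 0) - 1 / p)) ^ 2 ≤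
      N * ∑ p ∈ B, c p / p + 3 * (B.card : ℝ) ^ 2 := by
  simp_rw [sq, Finset.sum_mul_sum]
  rw [Finset.sum_comm]
  have : ∀ p ∈ B, ∑ n ∈ Finset.Icc 1 N, ∑ q ∈ B,
      c p * ((if p ∣ n then (1 : ℝ) else 0) - 1 / p) *
        (c q * ((if q ∣ n then (1 : ℝ) else 0) - 1 / q)) ≤ N * (c p / p) + 3 * B.card := by
    intro p hp
    rw [Finset.sum_comm]
    calc _ ≤ ∑ q ∈ B, ((if q = p then N * (c p / p) else 0) + 3) := by
          refine Finset.sum_le_sum fun q hq => ?_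
          have e : ∀ n : ℕ, c p * ((if p ∣ n then (1 : ℝ) else 0) - 1 / p) *
              (c q * ((if q ∣ n then (1 : ℝ) else 0) - 1 / q)) = (c p * c q) *
              (((if p ∣ n then (1 : ℝ) else 0) - 1 / p) *
                ((if q ∣ n then (1 : ℝ) else 0) - 1 / q)) := fun n => by ring
          simp_rw [e]
          rw [← Finset.mul_sum]
          have hcc : c p * c q ≤ 1 := mul_le_one₀ (hc p).2 (hc q).1 (hc q).2
          have hcc0 : 0 ≤ c p * c q := mul_nonneg (hc p).1 (hc q).1
          split_ifs with h
          · subst h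
            have h0 : (0 : ℝ) ≤ N / q := by positivity
            have h1 := mul_le_mul_of_nonneg_left (sum_dvd_variance_le (hB q hp) N) hcc0
            have h2 : c q * c q ≤ c q := mul_le_of_le_one_left (hc q).1 (hc q).2
            have h3 := mul_le_mul_of_nonneg_right h2 h0
            have h4 : c q * ((N : ℝ) / q) = N * (c q / q) := by ring
            linarith
          · have h1 := sum_dvd_covariance_le (hB p hp) (hB q hq) (Ne.symm h) N
            have h2 := mul_le_mul_of_nonneg_left ((le_abs_self _).trans h1) hcc0
            linarith
      _ = N * (c p / p) + 3 * B.card := by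
          rw [Finset.sum_add_distrib, Finset.sum_ite_eq' B p]
          simp [hp, mul_comm]
  refine (Finset.sum_le_sum this).trans (le_of_eq ?_)
  rw [Finset.sum_add_distrib, Finset.mul_sum]
  simp
  ring

/-- Bounded functions are almost orthogonal to `∑ c_p (1_{p ∣ n} - 1 / p)`. -/
lemma norm_sum_dilate_sub_le {B : Finset ℕ} (hB : ∀ p ∈ B, p.Prime) {c : ℕ → ℝ}
    (hc : ∀ p, 0 ≤ c p ∧ c p ≤ 1) {F : ℕ → ℂ} {A : ℝ} (hF : ∀ n, ‖F n‖ ≤ A) (N : ℕ) :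
    ‖∑ p ∈ B, (c p : ℂ) * ∑ n ∈ Finset.Icc 1 (N / p), F (p * n) -
      ((∑ p ∈ B, c p / p : ℝ) : ℂ) * ∑ n ∈ Finset.Icc 1 N, F n‖ ≤
      A * (N * √(∑ p ∈ B, c p / p) + √N * (2 * B.card)) := by
  have hA : 0 ≤ A := (norm_nonneg _).trans (hF 0)
  have hL : 0 ≤ ∑ p ∈ B, c p / p :=
    Finset.sum_nonneg fun p _ => div_nonneg (hc p).1 (Nat.cast_nonneg p)
  set L := ∑ p ∈ B, c p / p with hLdef
  have e : ∑ p ∈ B, (c p : ℂ) * ∑ n ∈ Finset.Icc 1 (N / p), F (p * n) -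
      (L : ℂ) * ∑ n ∈ Finset.Icc 1 N, F n = ∑ n ∈ Finset.Icc 1 N, F n *
      ((∑ p ∈ B, c p * ((if p ∣ n then (1 : ℝ) else 0) - 1 / p) : ℝ) : ℂ) := by
    have h1 : ∀ p ∈ B, (c p : ℂ) * ∑ n ∈ Finset.Icc 1 (N / p), F (p * n) =
        ∑ n ∈ Finset.Icc 1 N, F n * ((c p * (if p ∣ n then (1 : ℝ) else 0) : ℝ) : ℂ) := by
      intro p hp
      rw [← sum_Icc_ite_dvd F (hB p hp).pos, Finset.mul_sum]
      refine Finset.sum_congr rfl fun n _ => ?_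
      split_ifs <;> simp [mul_comm]
    rw [Finset.sum_congr rfl h1, Finset.sum_comm, Finset.mul_sum, ← Finset.sum_sub_distrib]
    refine Finset.sum_congr rfl fun n _ => ?_
    have h2 : (∑ p ∈ B, c p * ((if p ∣ n then (1 : ℝ) else 0) - 1 / p)) =
        (∑ p ∈ B, c p * (if p ∣ n then (1 : ℝ) else 0)) - L := by
      rw [hLdef, ← Finset.sum_sub_distrib]
      refine Finset.sum_congr rfl fun p _ => ?_
      ring
    rw [h2, ← Finset.mul_sum]
    push_cast
    ring
  rw [e]
  set D : ℕ → ℝ := fun n => ∑ p ∈ B, c p * ((if p ∣ n then (1 : ℝ) else 0) - 1 / p)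
  have h1 : ‖∑ n ∈ Finset.Icc 1 N, F n * (D n : ℂ)‖ ≤ A * ∑ n ∈ Finset.Icc 1 N, |D n| * 1 := by
    refine (norm_sum_le _ _).trans ?_
    rw [Finset.mul_sum]
    refine Finset.sum_le_sum fun n _ => ?_
    rw [norm_mul, Complex.norm_real, Real.norm_eq_abs, mul_one]
    exact mul_le_mul_of_nonneg_right (hF n) (abs_nonneg _)
  refine h1.trans (mul_le_mul_of_nonneg_left ?_ hA)
  refine le_of_sq_le_sq ?_ (by positivity)
  refine (Finset.sum_mul_sq_le_sq_mul_sq _ _ _).trans ?_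
  have h2 : ∑ n ∈ Finset.Icc 1 N, |D n| ^ 2 ≤ N * L + 3 * (B.card : ℝ) ^ 2 := by
    simp_rw [sq_abs]
    exact turanKubilius hB hc N
  have h3 : ∑ n ∈ Finset.Icc 1 N, (1 : ℝ) ^ 2 = N := by simp
  rw [h3]
  have s1 : √L ^ 2 = L := Real.sq_sqrt hL
  have s2 : √(N : ℝ) ^ 2 = N := Real.sq_sqrt (Nat.cast_nonneg N)
  have h4 := mul_le_mul_of_nonneg_right h2 (Nat.cast_nonneg (α := ℝ) N)
  refine h4.trans ?_
  -- The constant 2 in `2 * B.card` was chosen so that its square, 4, absorbs the 3 of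
  -- `turanKubilius`; the cross term is dropped.
  have h5 : 0 ≤ N * √L * (√N * (2 * B.card)) := by positivity
  have h6 : 0 ≤ (N : ℝ) * (B.card : ℝ) ^ 2 := by positivity
  have h7 : (N * √L + √N * (2 * B.card)) ^ 2 = N ^ 2 * (√L ^ 2) + 2 * (N * √L * (√N * (2 * B.card)))
      + √(N : ℝ) ^ 2 * (4 * (B.card : ℝ) ^ 2) := by ring
  rw [h7, s1, s2]
  nlinarith

/-! ### Averages on the logarithmic scale -/

/-- The average of `F` over `[1, e ^ u]`. -/
noncomputable def logAverage (F : ℕ → ℂ) (u : ℝ) : ℂ :=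
  (Real.exp (-u) : ℂ) * ∑ n ∈ Finset.Icc 1 ⌊Real.exp u⌋₊, F n

lemma norm_sum_Icc_le {F : ℕ → ℂ} {A : ℝ} (hF : ∀ n, ‖F n‖ ≤ A) (M N : ℕ) :
    ‖∑ n ∈ Finset.Ioc M N, F n‖ ≤ A * (N - M : ℕ) := by
  refine (norm_sum_le_of_le _ fun n _ => hF n).trans (le_of_eq ?_)
  simp [mul_comm]

lemma measurable_logAverage (F : ℕ → ℂ) : Measurable (logAverage F) := by
  refine Measurable.mul (by fun_prop) ?_
  exact (measurable_of_countable fun N : ℕ => ∑ n ∈ Finset.Icc 1 N, F n).comp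
    (Nat.measurable_floor.comp Real.measurable_exp)

lemma norm_logAverage_le {F : ℕ → ℂ} {A : ℝ} (hF : ∀ n, ‖F n‖ ≤ A) (u : ℝ) :
    ‖logAverage F u‖ ≤ A := by
  have hA : 0 ≤ A := (norm_nonneg _).trans (hF 0)
  rw [logAverage, norm_mul, Complex.norm_real, Real.norm_of_nonneg (Real.exp_pos _).le]
  have h := norm_sum_Icc_le hF 0 ⌊Real.exp u⌋₊
  have h1 : (⌊Real.exp u⌋₊ : ℝ) ≤ Real.exp u := Nat.floor_le (Real.exp_pos _).le
  rw [Nat.sub_zero] at h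
  have h2 := h.trans (mul_le_mul_of_nonneg_left h1 hA)
  calc _ ≤ Real.exp (-u) * (A * Real.exp u) :=
        mul_le_mul_of_nonneg_left h2 (Real.exp_pos _).le
    _ = A := by rw [mul_left_comm, ← Real.exp_add]; simp

/-- The Tauberian condition of slow oscillation. Going from v to u adds the terms in (e^v, e^u] and
changes the normalisation; both cost A(1 - e^{v-u}) ≤ A(u - v), and rounding the endpoints costs A
e^{-u}. -/
lemma norm_logAverage_sub_le_of_le {F : ℕ → ℂ} {A : ℝ} (hF : ∀ n, ‖F n‖ ≤ A) {u v : ℝ}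
    (h : v ≤ u) :
    ‖logAverage F u - logAverage F v‖ ≤ 2 * A * (u - v) + A * Real.exp (-u) := by
  have hA : 0 ≤ A := (norm_nonneg _).trans (hF 0)
  have huv : Real.exp v ≤ Real.exp u := Real.exp_le_exp.2 h
  have hfl : ⌊Real.exp v⌋₊ ≤ ⌊Real.exp u⌋₊ := Nat.floor_le_floor huv
  have hS : ∑ n ∈ Finset.Icc 1 ⌊Real.exp u⌋₊, F n = ∑ n ∈ Finset.Icc 1 ⌊Real.exp v⌋₊, F n +
      ∑ n ∈ Finset.Ioc ⌊Real.exp v⌋₊ ⌊Real.exp u⌋₊, F n := by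
    exact (Finset.sum_Ioc_consecutive F (Nat.zero_le _) hfl).symm
  have e : logAverage F u - logAverage F v =
      (Real.exp (-u) : ℂ) * ∑ n ∈ Finset.Ioc ⌊Real.exp v⌋₊ ⌊Real.exp u⌋₊, F n +
      ((Real.exp (v - u) - 1 : ℝ) : ℂ) * logAverage F v := by
    have h1 : (Real.exp (-u) : ℂ) = (Real.exp (v - u) : ℂ) * (Real.exp (-v) : ℂ) := by
      rw [← Complex.ofReal_mul, ← Real.exp_add]
      congr 2
      ring
    rw [logAverage, logAverage, hS, mul_add, Complex.ofReal_sub, sub_mul, ← mul_assoc, ← h1]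
    push_cast
    ring
  have hexp : v - u + 1 ≤ Real.exp (v - u) := Real.add_one_le_exp _
  have hexp1 : Real.exp (v - u) ≤ 1 := Real.exp_le_one_iff.2 (by linarith)
  rw [e]
  refine (norm_add_le _ _).trans ?_
  rw [norm_mul, norm_mul, Complex.norm_real, Complex.norm_real,
    Real.norm_of_nonneg (Real.exp_pos _).le, Real.norm_eq_abs, abs_sub_comm,
    abs_of_nonneg (by linarith : 0 ≤ 1 - Real.exp (v - u))]
  have h1 := norm_sum_Icc_le hF ⌊Real.exp v⌋₊ ⌊Real.exp u⌋₊
  have h2 : ((⌊Real.exp u⌋₊ - ⌊Real.exp v⌋₊ : ℕ) : ℝ) ≤ Real.exp u - Real.exp v + 1 := by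
    rw [Nat.cast_sub hfl]
    have := Nat.lt_floor_add_one (Real.exp v)
    have := Nat.floor_le (Real.exp_pos u).le
    linarith
  have h3 := mul_le_mul_of_nonneg_left (h1.trans (mul_le_mul_of_nonneg_left h2 hA))
    (Real.exp_pos (-u)).le
  have h4 : Real.exp (-u) * (A * (Real.exp u - Real.exp v + 1)) =
      A * (1 - Real.exp (v - u)) + A * Real.exp (-u) := by
    have a1 : Real.exp (-u) * Real.exp u = 1 := by rw [← Real.exp_add]; simp
    have a2 : Real.exp (-u) * Real.exp v = Real.exp (v - u) := by
      rw [← Real.exp_add]; congr 1; ring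
    calc _ = A * (Real.exp (-u) * Real.exp u - Real.exp (-u) * Real.exp v + Real.exp (-u)) := by ring
      _ = _ := by rw [a1, a2]; ring
  have h5 := mul_le_mul (by linarith : 1 - Real.exp (v - u) ≤ u - v) (norm_logAverage_le hF v)
    (norm_nonneg _) (by linarith)
  have h6 := mul_le_mul_of_nonneg_left (by linarith : 1 - Real.exp (v - u) ≤ u - v) hA
  linarith

lemma norm_logAverage_sub_le {F : ℕ → ℂ} {A : ℝ} (hF : ∀ n, ‖F n‖ ≤ A) (u v : ℝ) :
    ‖logAverage F u - logAverage F v‖ ≤ 2 * A * |u - v| + A * Real.exp (-u) := by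
  have hA : 0 ≤ A := (norm_nonneg _).trans (hF 0)
  rcases le_total v u with h | h
  · rw [abs_of_nonneg (sub_nonneg.2 h)]
    exact norm_logAverage_sub_le_of_le hF h
  · rw [norm_sub_rev, abs_sub_comm, abs_of_nonneg (sub_nonneg.2 h)]
    refine (norm_logAverage_sub_le_of_le hF h).trans ?_
    have := mul_le_mul_of_nonneg_left (Real.exp_le_exp.2 (neg_le_neg h)) hA
    linarith

/-- This is `norm_sum_dilate_sub_le` divided by e^u. The sum of F₁ up to e^u/p is an average at u -
log p, weighted by 1/p, so the dilates turn into a superposition of translates. -/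
lemma norm_logAverage_dilate_le {B : Finset ℕ} (hB : ∀ p ∈ B, p.Prime) {c : ℕ → ℝ}
    (hc : ∀ p, 0 ≤ c p ∧ c p ≤ 1) {F₀ F₁ : ℕ → ℂ} {A : ℝ} (hF : ∀ n, ‖F₀ n‖ ≤ A)
    (hF₁ : ∀ p ∈ B, ∀ n, 1 ≤ n → F₀ (p * n) = F₁ n) (u : ℝ) :
    ‖((∑ p ∈ B, c p / p : ℝ) : ℂ) * logAverage F₀ u -
      ∑ p ∈ B, ((c p / p : ℝ) : ℂ) * logAverage F₁ (u - Real.log p)‖ ≤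
      A * √(∑ p ∈ B, c p / p) + A * (2 * B.card) * Real.exp (-u / 2) := by
  have hA : 0 ≤ A := (norm_nonneg _).trans (hF 0)
  set N := ⌊Real.exp u⌋₊ with hN
  have e1 : ∀ p ∈ B, ((c p / p : ℝ) : ℂ) * logAverage F₁ (u - Real.log p) =
      (Real.exp (-u) : ℂ) * ((c p : ℂ) * ∑ n ∈ Finset.Icc 1 (N / p), F₀ (p * n)) := by
    intro p hp
    have hp0 : (0 : ℝ) < p := by exact_mod_cast (hB p hp).pos
    have h1 : Real.exp (u - Real.log p) = Real.exp u / p := by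
      rw [Real.exp_sub, Real.exp_log hp0]
    have h2 : Real.exp (-(u - Real.log p)) = Real.exp (-u) * p := by
      rw [neg_sub, sub_eq_add_neg, Real.exp_add, Real.exp_log hp0, mul_comm]
    rw [logAverage, h1, h2, Nat.floor_div_natCast, ← hN]
    rw [Finset.sum_congr rfl fun n hn => hF₁ p hp n (Finset.mem_Icc.1 hn).1]
    have : (p : ℂ) ≠ 0 := by exact_mod_cast hp0.ne'
    push_cast
    field_simp
  rw [Finset.sum_congr rfl e1, ← Finset.mul_sum, logAverage, ← hN, mul_left_comm, ← mul_sub,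
    norm_mul, norm_sub_rev, Complex.norm_real, Real.norm_of_nonneg (Real.exp_pos _).le]
  have h1 := mul_le_mul_of_nonneg_left (norm_sum_dilate_sub_le hB hc hF N) (Real.exp_pos (-u)).le
  refine h1.trans ?_
  have hNu : (N : ℝ) ≤ Real.exp u := Nat.floor_le (Real.exp_pos u).le
  have hsq : √(N : ℝ) ≤ Real.exp (u / 2) := by
    rw [Real.exp_half]
    exact Real.sqrt_le_sqrt hNu
  have a1 : Real.exp (-u) * Real.exp u = 1 := by rw [← Real.exp_add]; simp
  have a2 : Real.exp (-u) * Real.exp (u / 2) = Real.exp (-u / 2) := by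
    rw [← Real.exp_add]; congr 1; ring
  calc Real.exp (-u) * (A * (N * √(∑ p ∈ B, c p / p) + √N * (2 * B.card)))
      ≤ Real.exp (-u) * (A * (Real.exp u * √(∑ p ∈ B, c p / p) +
        Real.exp (u / 2) * (2 * B.card))) := by gcongr
    _ = A * √(∑ p ∈ B, c p / p) * (Real.exp (-u) * Real.exp u) +
        A * (2 * B.card) * (Real.exp (-u) * Real.exp (u / 2)) := by ring
    _ = _ := by rw [a1, a2]; ring

/-! ### Primes congruent to `1` weighted so that their logarithms equidistribute -/

open ArithmeticFunction.vonMangoldt in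
-- Once the pole at s = 1 is subtracted, the series is continuous on Re s ≥ 1, hence bounded on a
-- compact rectangle; the polar part is bounded because |s - 1| ≥ |Im s| ≥ η.
lemma exists_norm_LSeries_residueClass_le (q : ℕ) [NeZero q] {η : ℝ} (hη : 0 < η) (R : ℝ) :
    ∃ C : ℝ, ∀ s : ℂ, 1 < s.re → s.re ≤ 2 → η ≤ |s.im| → |s.im| ≤ R →
      ‖LSeries (fun n => (residueClass (1 : ZMod q) n : ℂ)) s‖ ≤ C := by
  have hcomp : IsCompact (Set.Icc (1 : ℝ) 2 ×ℂ Set.Icc (-R) R) :=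
    isCompact_Icc.reProdIm isCompact_Icc
  have hcont : ContinuousOn (LFunctionResidueClassAux (1 : ZMod q))
      (Set.Icc (1 : ℝ) 2 ×ℂ Set.Icc (-R) R) :=
    (continuousOn_LFunctionResidueClassAux (1 : ZMod q)).mono fun s hs => hs.1.1
  obtain ⟨C, hC⟩ := hcomp.exists_bound_of_continuousOn hcont
  refine ⟨C + ‖(q.totient : ℂ)⁻¹‖ / η, fun s h1 h2 h3 h4 => ?_⟩
  have he := eqOn_LFunctionResidueClassAux (a := (1 : ZMod q)) isUnit_one (x := s) h1
  have he' : LSeries (fun n => (residueClass (1 : ZMod q) n : ℂ)) s =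
      LFunctionResidueClassAux (1 : ZMod q) s + (q.totient : ℂ)⁻¹ / (s - 1) := by
    rw [he]; ring
  rw [he']
  refine (norm_add_le _ _).trans (add_le_add (hC s ⟨⟨h1.le, h2⟩, abs_le.1 h4⟩) ?_)
  rw [norm_div]
  refine div_le_div_of_nonneg_left (norm_nonneg _) hη (h3.trans ?_)
  simpa using Complex.abs_im_le_norm (s - 1)

open ArithmeticFunction.vonMangoldt in
-- The point is that C does not depend on δ. Proper prime powers contribute a series that converges
-- already at s = 1, and the tail of the series beyond a finite set is small uniformly in Re s ≥ 1 +
-- δ.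
lemma exists_finset_primes_LSeries (q : ℕ) [NeZero q] : ∃ C : ℝ, ∀ δ : ℝ, 0 < δ →
    ∃ B : Finset ℕ, (∀ p ∈ B, p.Prime ∧ (p : ZMod q) = 1) ∧ ∀ s : ℂ, 1 + δ ≤ s.re →
      ‖LSeries (fun n => (residueClass (1 : ZMod q) n : ℂ)) s -
        ∑ p ∈ B, (Real.log p : ℂ) * Complex.exp (-s * Real.log p)‖ ≤ C := by
  classical
  set np : ℕ → ℝ := fun n => (if n.Prime then 0 else residueClass (1 : ZMod q) n) / n with hnp
  have hnps : Summable np := summable_residueClass_non_primes_div (1 : ZMod q)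
  refine ⟨∑' n, np n + 1, fun δ hδ => ?_⟩
  have hsum : ∀ s : ℂ, 1 < s.re →
      LSeriesSummable (fun n => (residueClass (1 : ZMod q) n : ℂ)) s := fun s hs =>
    LSeriesSummable_of_abscissaOfAbsConv_lt_re
      ((abscissaOfAbsConv_residueClass_le_one (1 : ZMod q)).trans_lt (by exact_mod_cast hs))
  -- The terms at the real point 1 + δ dominate those at every s with Re s ≥ 1 + δ, so a single
  -- cut-off `B₀` serves all s.
  set u : ℕ → ℝ := fun n =>
    ‖LSeries.term (fun n => (residueClass (1 : ZMod q) n : ℂ)) ((1 + δ : ℝ) : ℂ) n‖ with hu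
  have hus : Summable u := (hsum _ (by rw [Complex.ofReal_re]; linarith)).norm
  obtain ⟨B₀, hB₀⟩ := ((tendsto_tsum_compl_atTop_zero u).eventually
    (gt_mem_nhds one_pos)).exists
  have hterm : ∀ s : ℂ, ∀ n : ℕ, n ≠ 0 →
      LSeries.term (fun n => (residueClass (1 : ZMod q) n : ℂ)) s n =
        residueClass (1 : ZMod q) n * Complex.exp (-s * Real.log n) := by
    intro s n hn
    rw [LSeries.term_of_ne_zero hn, Complex.cpow_def_of_ne_zero (by exact_mod_cast hn),
      div_eq_mul_inv, ← Complex.exp_neg, ← Complex.natCast_log]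
    congr 2
    ring
  have hnorm : ∀ s : ℂ, ∀ n : ℕ, n ≠ 0 →
      ‖LSeries.term (fun n => (residueClass (1 : ZMod q) n : ℂ)) s n‖ =
        residueClass (1 : ZMod q) n * Real.exp (-s.re * Real.log n) := by
    intro s n hn
    rw [hterm s n hn, norm_mul, Complex.norm_real, Complex.norm_exp,
      Real.norm_of_nonneg (residueClass_nonneg _ _), Complex.re_mul_ofReal, Complex.neg_re]
  have hmono : ∀ s : ℂ, ∀ x : ℝ, x ≤ s.re → ∀ n : ℕ, n ≠ 0 →
      ‖LSeries.term (fun n => (residueClass (1 : ZMod q) n : ℂ)) s n‖ ≤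
        residueClass (1 : ZMod q) n * Real.exp (-x * Real.log n) := by
    intro s x hx n hn
    rw [hnorm s n hn]
    refine mul_le_mul_of_nonneg_left (Real.exp_le_exp.2 ?_) (residueClass_nonneg _ _)
    exact mul_le_mul_of_nonneg_right (neg_le_neg hx) (Real.log_natCast_nonneg n)
  set B := B₀.filter fun p : ℕ => p.Prime ∧ (p : ZMod q) = 1 with hB
  refine ⟨B, fun p hp => (Finset.mem_filter.1 hp).2, fun s hs => ?_⟩
  have hs1 : 1 < s.re := by linarith
  have e1 : ∑ p ∈ B, (Real.log p : ℂ) * Complex.exp (-s * Real.log p) =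
      ∑ p ∈ B, LSeries.term (fun n => (residueClass (1 : ZMod q) n : ℂ)) s p := by
    refine Finset.sum_congr rfl fun p hp => ?_
    obtain ⟨hpp, hp1⟩ := (Finset.mem_filter.1 hp).2
    rw [hterm s p hpp.ne_zero]
    congr 2
    rw [residueClass, Set.indicator_of_mem (show p ∈ {n : ℕ | (n : ZMod q) = 1} from hp1),
      ArithmeticFunction.vonMangoldt_apply_prime hpp]
  set t := LSeries.term (fun n => (residueClass (1 : ZMod q) n : ℂ)) s with ht
  have hts : Summable t := hsum s hs1
  have e2 : LSeries (fun n => (residueClass (1 : ZMod q) n : ℂ)) s - ∑ p ∈ B, t p =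
      ∑' n, (t n - if n ∈ B then t n else 0) := by
    rw [Summable.tsum_sub hts (summable_of_ne_finset_zero (s := B) fun n hn => if_neg hn)]
    rw [tsum_eq_sum (s := B) (f := fun n => if n ∈ B then t n else 0) fun n hn => if_neg hn]
    rw [Finset.sum_congr rfl fun n hn => if_pos hn]
    rfl
  rw [e1, e2]
  have hind : HasSum ((B₀ : Set ℕ)ᶜ.indicator u) (∑' n : {x // x ∉ B₀}, u n) := by
    have := (hus.subtype (fun x => x ∉ B₀)).hasSum
    exact (hasSum_subtype_iff_indicator (s := (B₀ : Set ℕ)ᶜ)).1 this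
  refine (tsum_of_norm_bounded (hnps.hasSum.add hind) fun n => ?_).trans (by linarith)
  have hnp0 : 0 ≤ np n := by
    rw [hnp]
    refine div_nonneg ?_ (Nat.cast_nonneg n)
    split_ifs
    exacts [le_rfl, residueClass_nonneg _ _]
  have hu0 : 0 ≤ (B₀ : Set ℕ)ᶜ.indicator u n :=
    Set.indicator_nonneg (fun _ _ => norm_nonneg _) _
  by_cases hn : n ∈ B
  · rw [if_pos hn, sub_self, norm_zero]
    exact add_nonneg hnp0 hu0
  rw [if_neg hn, sub_zero]
  rcases eq_or_ne n 0 with rfl | hn0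
  · rw [ht, LSeries.term_zero, norm_zero]
    exact add_nonneg hnp0 hu0
  by_cases hpr : n.Prime
  · by_cases hn1 : (n : ZMod q) = 1
    · have hnB : n ∉ B₀ := fun h => hn (Finset.mem_filter.2 ⟨h, hpr, hn1⟩)
      rw [Set.indicator_of_mem (show n ∈ (B₀ : Set ℕ)ᶜ from hnB)]
      have := hmono s _ hs n hn0
      have h2 : u n = residueClass (1 : ZMod q) n * Real.exp (-(1 + δ) * Real.log n) := by
        rw [hu]
        simp only
        rw [hnorm _ n hn0, Complex.ofReal_re]
      rw [h2]
      linarith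
    · rw [hnorm s n hn0, residueClass, Set.indicator_of_notMem
        (show n ∉ {n : ℕ | (n : ZMod q) = 1} from hn1), zero_mul]
      exact add_nonneg hnp0 hu0
  · have h1 := hmono s 1 hs1.le n hn0
    have h2 : np n = residueClass (1 : ZMod q) n * Real.exp (-1 * Real.log n) := by
      rw [hnp]
      simp only [if_neg hpr]
      rw [neg_one_mul, Real.exp_neg, Real.exp_log (by positivity), div_eq_mul_inv]
    linarith

/-- A finite family of weighted primes `p ≡ 1` mod `q` of large mass whose logarithms have bounded
exponential sums at frequencies away from `0`. -/
theorem exists_weighted_primes (q : ℕ) [NeZero q] {η : ℝ} (hη : 0 < η) (R : ℝ) :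
    ∃ C : ℝ, ∀ L : ℝ, ∃ (B : Finset ℕ) (c : ℕ → ℝ), (∀ p ∈ B, p.Prime ∧ (p : ZMod q) = 1) ∧
      (∀ p, 0 ≤ c p ∧ c p ≤ 1) ∧ L ≤ ∑ p ∈ B, c p / p ∧ ∀ ξ : ℝ, η ≤ |ξ| → |ξ| ≤ R →
        ‖∑ p ∈ B, ((c p / p : ℝ) : ℂ) * Real.fourierChar (-(Real.log p * ξ))‖ ≤ C ∧
        ‖∑ p ∈ B, ((c p / p * Real.log p : ℝ) : ℂ) *
          Real.fourierChar (-(Real.log p * ξ))‖ ≤ C := by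
  -- With the normalisation e(-ξ log p) = p^{-2πiξ}, frequency ξ corresponds to Im s = 2πξ.
  obtain ⟨C₁, hC₁⟩ := exists_norm_LSeries_residueClass_le q
    (η := 2 * Real.pi * η) (by positivity) (2 * Real.pi * R)
  obtain ⟨C₂, hC₂⟩ := exists_finset_primes_LSeries q
  obtain ⟨C₃, hC₃⟩ := ArithmeticFunction.vonMangoldt.LSeries_residueClass_lower_bound
    (q := q) (a := 1) isUnit_one
  refine ⟨2 * (C₁ + C₂), fun L => ?_⟩
  set φ : ℝ := (q.totient : ℝ)⁻¹ with hφ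
  have hφ0 : 0 < φ := by
    have := Nat.totient_pos.2 (NeZero.pos q)
    positivity
  -- The total mass will be at least φ log(1/δ) minus a constant, which exceeds L for small δ.
  obtain ⟨δ, hδ0, hδ1, hδL⟩ : ∃ δ : ℝ, 0 < δ ∧ δ < 1 ∧ L ≤ -φ * Real.log δ - |C₂ + C₃| := by
    have ht : Tendsto (fun δ : ℝ => -φ * Real.log δ - |C₂ + C₃|) (𝓝[>] 0) atTop := by
      refine tendsto_atTop_add_const_right _ _ ?_
      exact Tendsto.const_mul_atBot_of_neg (by linarith) Real.tendsto_log_nhdsGT_zero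
    have h1 : ∀ᶠ δ : ℝ in 𝓝[>] 0, δ ∈ Set.Ioo (0 : ℝ) 1 := Ioo_mem_nhdsGT one_pos
    obtain ⟨δ, h2, h3⟩ := ((ht.eventually_ge_atTop L).and h1).exists
    exact ⟨δ, h3.1, h3.2, h2⟩
  obtain ⟨B, hB, hBs⟩ := hC₂ δ hδ0
  have hexp : ∀ p ∈ B, ∀ x : ℝ,
      Real.exp (-(1 + x) * Real.log p) = Real.exp (-x * Real.log p) / p := by
    intro p hp x
    have hp0 : (0 : ℝ) < p := by exact_mod_cast (hB p hp).1.pos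
    rw [neg_add, add_mul, Real.exp_add, neg_one_mul, Real.exp_neg, Real.exp_log hp0]
    ring
  have hθ : ∀ σ ξ : ℝ, δ ≤ σ → σ ≤ 1 → η ≤ |ξ| → |ξ| ≤ R →
      ‖∑ p ∈ B, ((Real.log p * Real.exp (-(1 + σ) * Real.log p) : ℝ) : ℂ) *
        Real.fourierChar (-(Real.log p * ξ))‖ ≤ C₁ + C₂ := by
    intro σ ξ h1 h2 h3 h4
    have him : |2 * Real.pi * ξ| = 2 * Real.pi * |ξ| := by
      rw [abs_mul, abs_of_pos Real.two_pi_pos]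
    have a1 := hBs (((1 + σ : ℝ) : ℂ) + ((2 * Real.pi * ξ : ℝ) : ℂ) * Complex.I) (by simp; linarith)
    have a2 := hC₁ (((1 + σ : ℝ) : ℂ) + ((2 * Real.pi * ξ : ℝ) : ℂ) * Complex.I)
      (by simp; linarith) (by simp; linarith)
      (by
        have : (((1 + σ : ℝ) : ℂ) + ((2 * Real.pi * ξ : ℝ) : ℂ) * Complex.I).im =
          2 * Real.pi * ξ := by simp
        rw [this, him]; gcongr)
      (by
        have : (((1 + σ : ℝ) : ℂ) + ((2 * Real.pi * ξ : ℝ) : ℂ) * Complex.I).im =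
          2 * Real.pi * ξ := by simp
        rw [this, him]; gcongr)
    rw [norm_sub_rev] at a1
    have e : ∀ p : ℕ, (Real.log p : ℂ) * Complex.exp
        (-(((1 + σ : ℝ) : ℂ) + ((2 * Real.pi * ξ : ℝ) : ℂ) * Complex.I) * Real.log p) =
        ((Real.log p * Real.exp (-(1 + σ) * Real.log p) : ℝ) : ℂ) *
          Real.fourierChar (-(Real.log p * ξ)) := by
      intro p
      rw [Real.fourierChar_apply, Complex.ofReal_mul (Real.log p), Complex.ofReal_exp,
        mul_assoc (Real.log p : ℂ),
        ← Complex.exp_add]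
      congr 2
      push_cast
      ring
    simp_rw [e] at a1
    have := norm_le_norm_add_norm_sub' (∑ p ∈ B,
      ((Real.log p * Real.exp (-(1 + σ) * Real.log p) : ℝ) : ℂ) *
          Real.fourierChar (-(Real.log p * ξ)))
      (LSeries (fun n => (ArithmeticFunction.vonMangoldt.residueClass (1 : ZMod q) n : ℂ))
        (((1 + σ : ℝ) : ℂ) + ((2 * Real.pi * ξ : ℝ) : ℂ) * Complex.I))
    linarith
  have hθr : ∀ σ : ℝ, δ ≤ σ → σ ≤ 1 →
      φ / σ - (C₂ + C₃) ≤ ∑ p ∈ B, Real.log p * Real.exp (-(1 + σ) * Real.log p) := by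
    intro σ h1 h2
    have a1 := hBs ((1 + σ : ℝ) : ℂ) (by simp; linarith)
    have a2 := hC₃ (x := 1 + σ) ⟨by linarith, by linarith⟩
    rw [add_sub_cancel_left] at a2
    have e : ∀ p : ℕ, (Real.log p : ℂ) * Complex.exp (-((1 + σ : ℝ) : ℂ) * Real.log p) =
        ((Real.log p * Real.exp (-(1 + σ) * Real.log p) : ℝ) : ℂ) := by
      intro p
      push_cast
      rfl
    have e2 : LSeries (fun n => (ArithmeticFunction.vonMangoldt.residueClass (1 : ZMod q) n : ℂ))
        ((1 + σ : ℝ) : ℂ) = ((∑' n : ℕ, ArithmeticFunction.vonMangoldt.residueClass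
          (1 : ZMod q) n / (n : ℝ) ^ (1 + σ) : ℝ) : ℂ) := by
      rw [LSeries, Complex.ofReal_tsum]
      refine tsum_congr fun n => ?_
      rcases eq_or_ne n 0 with rfl | hn
      · simp only [LSeries.term_zero, ArithmeticFunction.vonMangoldt.residueClass_apply_zero,
          Complex.ofReal_zero, zero_div]
      · rw [LSeries.term_of_ne_zero hn, Complex.ofReal_div,
          Complex.ofReal_cpow (Nat.cast_nonneg n), Complex.ofReal_natCast]
    simp_rw [e] at a1
    rw [e2, ← Complex.ofReal_sum, ← Complex.ofReal_sub, Complex.norm_real, Real.norm_eq_abs] at a1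
    have := (abs_le.1 a1).2
    linarith
  -- This makes c_p/p = p^{-1-δ} - p^{-2} = ∫_δ^1 (log p) p^{-1-σ} dσ. Bounds for (log p)-weighted
  -- prime sums that are uniform in σ thus pass to the sums of c_p/p by integration, and those of
  -- (c_p/p) log p are differences of their values at σ = δ and σ = 1.
  set c : ℕ → ℝ := fun p => Real.exp (-δ * Real.log p) - Real.exp (-1 * Real.log p) with hc
  refine ⟨B, c, hB, fun p => ?_, ?_, fun ξ h3 h4 => ⟨?_, ?_⟩⟩
  · have hl := Real.log_natCast_nonneg p
    have h1 : Real.exp (-1 * Real.log p) ≤ Real.exp (-δ * Real.log p) := by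
      refine Real.exp_le_exp.2 (mul_le_mul_of_nonneg_right (by linarith) hl)
    have h2 : Real.exp (-δ * Real.log p) ≤ 1 :=
      Real.exp_le_one_iff.2 (by nlinarith)
    have h3 := Real.exp_pos (-1 * Real.log p)
    simp only [hc]
    constructor <;> linarith
  · set g : ℝ → ℝ := fun σ => ∑ p ∈ B, Real.exp (-(1 + σ) * Real.log p) + φ * Real.log σ
      - (C₂ + C₃) * σ with hg
    have hder : ∀ σ : ℝ, 0 < σ → HasDerivAt g
        (-(∑ p ∈ B, Real.log p * Real.exp (-(1 + σ) * Real.log p)) + φ / σ - (C₂ + C₃)) σ := by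
      intro σ hσ
      have h1 : HasDerivAt (fun σ : ℝ => ∑ p ∈ B, Real.exp (-(1 + σ) * Real.log p))
          (∑ p ∈ B, Real.exp (-(1 + σ) * Real.log p) * (-1 * Real.log p)) σ := by
        refine HasDerivAt.fun_sum fun p _ => HasDerivAt.exp ?_
        exact (((hasDerivAt_id σ).const_add 1).neg).mul_const _
      have h2 := ((h1.add ((Real.hasDerivAt_log hσ.ne').const_mul φ)).sub
        ((hasDerivAt_id σ).const_mul (C₂ + C₃)))
      refine h2.congr_deriv ?_
      rw [← Finset.sum_neg_distrib, mul_one, div_eq_mul_inv]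
      congr 2
      refine Finset.sum_congr rfl fun p _ => ?_
      ring
    have hanti : AntitoneOn g (Set.Icc δ 1) := by
      refine antitoneOn_of_deriv_nonpos (convex_Icc δ 1) ?_ ?_ ?_
      · exact fun σ hσ => (hder σ (hδ0.trans_le hσ.1)).continuousAt.continuousWithinAt
      · rw [interior_Icc]
        exact fun σ hσ => (hder σ (hδ0.trans hσ.1)).differentiableAt.differentiableWithinAt
      · rw [interior_Icc]
        intro σ hσ
        rw [(hder σ (hδ0.trans hσ.1)).deriv]
        have := hθr σ hσ.1.le hσ.2.le
        linarith
    have h1 := hanti ⟨le_rfl, hδ1.le⟩ ⟨hδ1.le, le_rfl⟩ hδ1.le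
    simp only [hg, Real.log_one] at h1
    have h2 : ∑ p ∈ B, c p / p = ∑ p ∈ B, Real.exp (-(1 + δ) * Real.log p) -
        ∑ p ∈ B, Real.exp (-(1 + 1) * Real.log p) := by
      rw [← Finset.sum_sub_distrib]
      refine Finset.sum_congr rfl fun p hp => ?_
      rw [hexp p hp, hexp p hp, ← sub_div]
    rw [h2]
    have h3 : (C₂ + C₃) * (1 - δ) ≤ |C₂ + C₃| :=
      (mul_le_mul_of_nonneg_right (le_abs_self _) (by linarith)).trans
        (mul_le_of_le_one_right (abs_nonneg _) (by linarith))
    linarith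
  · set g : ℝ → ℂ := fun σ => ∑ p ∈ B, ((Real.exp (-(1 + σ) * Real.log p) : ℝ) : ℂ) *
      Real.fourierChar (-(Real.log p * ξ)) with hg
    have hder : ∀ σ ∈ Set.Icc δ 1, HasDerivWithinAt g
        (-(∑ p ∈ B, ((Real.log p * Real.exp (-(1 + σ) * Real.log p) : ℝ) : ℂ) *
        Real.fourierChar (-(Real.log p * ξ)))) (Set.Icc δ 1) σ := by
      intro σ _
      have h1 : HasDerivAt g (∑ p ∈ B, ((Real.exp (-(1 + σ) * Real.log p) *
          (-1 * Real.log p) : ℝ) : ℂ) * Real.fourierChar (-(Real.log p * ξ))) σ := by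
        refine HasDerivAt.fun_sum fun p _ => HasDerivAt.mul_const (HasDerivAt.ofReal_comp
          (HasDerivAt.exp ?_)) _
        exact (((hasDerivAt_id σ).const_add 1).neg).mul_const _
      refine h1.hasDerivWithinAt.congr_deriv ?_
      rw [← Finset.sum_neg_distrib]
      refine Finset.sum_congr rfl fun p _ => ?_
      push_cast
      ring
    have h1 := (convex_Icc δ 1).norm_image_sub_le_of_norm_hasDerivWithin_le hder
      (fun σ hσ => by rw [norm_neg]; exact hθ σ ξ hσ.1 hσ.2 h3 h4) ⟨hδ1.le, le_rfl⟩ ⟨le_rfl, hδ1.le⟩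
    have h0 := (norm_nonneg _).trans (hθ 1 ξ hδ1.le le_rfl h3 h4)
    have h2 : ∑ p ∈ B, ((c p / p : ℝ) : ℂ) * Real.fourierChar (-(Real.log p * ξ)) = g δ - g 1 := by
      simp only [hg]
      rw [← Finset.sum_sub_distrib]
      refine Finset.sum_congr rfl fun p hp => ?_
      rw [hexp p hp, hexp p hp, ← sub_mul, ← Complex.ofReal_sub, ← sub_div]
    rw [h2]
    refine h1.trans ?_
    rw [Real.norm_eq_abs, abs_sub_comm, abs_of_pos (sub_pos.2 hδ1)]
    nlinarith
  · have h2 : ∑ p ∈ B, ((c p / p * Real.log p : ℝ) : ℂ) * Real.fourierChar (-(Real.log p * ξ)) =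
        ∑ p ∈ B, ((Real.log p * Real.exp (-(1 + δ) * Real.log p) : ℝ) : ℂ) *
          Real.fourierChar (-(Real.log p * ξ)) -
        ∑ p ∈ B, ((Real.log p * Real.exp (-(1 + 1) * Real.log p) : ℝ) : ℂ) *
          Real.fourierChar (-(Real.log p * ξ)) := by
      rw [← Finset.sum_sub_distrib]
      refine Finset.sum_congr rfl fun p hp => ?_
      rw [hexp p hp, hexp p hp, ← sub_mul, ← Complex.ofReal_sub, ← mul_sub, ← sub_div, mul_comm (_ / _)]
    rw [h2]
    refine (norm_sub_le _ _).trans ?_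
    have a1 := hθ δ ξ le_rfl hδ1.le h3 h4
    have a2 := hθ 1 ξ hδ1.le le_rfl h3 h4
    linarith

/-! ### Superpositions of translates of a band-limited Schwartz function -/

open FourierTransform SchwartzMap LineDeriv

lemma fourier_sum_translates {ι : Type*} (s : Finset ι) (b t : ι → ℝ) (K : 𝓢(ℝ, ℂ)) (ξ : ℝ) :
    𝓕 (∑ i ∈ s, (b i : ℂ) • K.compSubConstCLM ℂ (t i)) ξ =
      (∑ i ∈ s, (b i : ℂ) * Real.fourierChar (-(t i * ξ))) * 𝓕 K ξ := by
  have h : ∀ a : ℝ, 𝓕 (K.compSubConstCLM ℂ a) ξ = Real.fourierChar (-(a * ξ)) * 𝓕 K ξ := by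
    intro a
    have := congrFun (Fourier.fourierIntegral_comp_add_right Real.fourierChar volume (K : ℝ → ℂ) (-a)) ξ
    rw [neg_mul] at this
    rw [fourier_coe, fourier_coe, Real.fourier_real_eq, Real.fourier_real_eq]
    exact this
  rw [← fourierTransformCLM_apply ℂ, map_sum, sum_apply, Finset.sum_mul]
  refine Finset.sum_congr rfl fun i _ => ?_
  rw [map_smul, smul_apply, fourierTransformCLM_apply, h, smul_eq_mul, mul_assoc]

/-- By Plancherel: the transform of the superposition is the exponential sum times the transform of
K, which lives on S. -/
lemma integral_norm_sq_sum_translates_le {K : 𝓢(ℝ, ℂ)} {S : Set ℝ} (hK : ∀ ξ ∉ S, 𝓕 K ξ = 0)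
    {ι : Type*} {s : Finset ι} {b t : ι → ℝ} {C : ℝ}
    (hC : ∀ ξ ∈ S, ‖∑ i ∈ s, (b i : ℂ) * Real.fourierChar (-(t i * ξ))‖ ≤ C) :
    ∫ v, ‖∑ i ∈ s, (b i : ℂ) * K (v - t i)‖ ^ 2 ≤ C ^ 2 * ∫ v, ‖K v‖ ^ 2 := by
  have e : ∀ v, ∑ i ∈ s, (b i : ℂ) * K (v - t i) =
      (∑ i ∈ s, (b i : ℂ) • K.compSubConstCLM ℂ (t i)) v := by
    intro v
    simp [sum_apply]
  have hint : ∀ f : 𝓢(ℝ, ℂ), Integrable fun v => ‖f v‖ ^ 2 := fun f =>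
    (f.memLp 2).integrable_norm_pow (by norm_num)
  simp_rw [e]
  rw [← integral_norm_sq_fourier, ← integral_norm_sq_fourier K, ← integral_const_mul]
  refine integral_mono (hint _) ((hint _).const_mul _) fun ξ => ?_
  simp only
  rw [fourier_sum_translates, norm_mul, mul_pow]
  by_cases hξ : ξ ∈ S
  · gcongr
    exact hC ξ hξ
  · simp [hK ξ hξ]

/-- Multiplication by v becomes differentiation on the Fourier side, and a function vanishing on the
open complement of S has zero derivative there. -/
lemma fourier_mul_id_eq_zero {K : 𝓢(ℝ, ℂ)} {S : Set ℝ} (hS : IsClosed S)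
    (hK : ∀ ξ ∉ S, 𝓕 K ξ = 0) {K₁ : 𝓢(ℝ, ℂ)} (hK₁ : ∀ v, K₁ v = v * K v) :
    ∀ ξ ∉ S, 𝓕 K₁ ξ = 0 := by
  intro ξ hξ
  have h := lineDerivOp_fourier_eq K (1 : ℝ)
  have hg : (fun x : ℝ => inner ℝ x (1 : ℝ)).HasTemperateGrowth := by fun_prop
  have e : smulLeftCLM ℂ (fun x : ℝ => inner ℝ x (1 : ℝ)) K = K₁ := by
    ext v
    rw [smulLeftCLM_apply_apply hg, hK₁]
    simp
  rw [e, ← fourierTransformCLM_apply ℂ (_ • _), map_smul, fourierTransformCLM_apply] at h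
  have h1 : ∂_{(1 : ℝ)} (𝓕 K) ξ = 0 := by
    rw [lineDerivOp_apply_eq_fderiv]
    have : ((𝓕 K : 𝓢(ℝ, ℂ)) : ℝ → ℂ) =ᶠ[𝓝 ξ] fun _ => 0 := by
      filter_upwards [hS.isOpen_compl.mem_nhds hξ] with x hx using hK x hx
    rw [this.fderiv_eq]
    simp
  rw [h, smul_apply, smul_eq_mul] at h1
  refine (mul_eq_zero.1 h1).resolve_left ?_
  simp [Real.pi_ne_zero]

/-- Superpositions of translates of a band-limited kernel are bounded in `L¹` as soon as the
corresponding exponential sums and their derivatives are bounded on the frequency band. -/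
theorem exists_integral_norm_sum_translates_le {K : 𝓢(ℝ, ℂ)} {S : Set ℝ} (hS : IsClosed S)
    (hK : ∀ ξ ∉ S, 𝓕 K ξ = 0) (C : ℝ) :
    ∃ D : ℝ, ∀ (s : Finset ℕ) (b t : ℕ → ℝ),
      (∀ ξ ∈ S, ‖∑ i ∈ s, (b i : ℂ) * Real.fourierChar (-(t i * ξ))‖ ≤ C) →
      (∀ ξ ∈ S, ‖∑ i ∈ s, ((b i * t i : ℝ) : ℂ) * Real.fourierChar (-(t i * ξ))‖ ≤ C) →
      ∫ v, ‖∑ i ∈ s, (b i : ℂ) * K (v - t i)‖ ≤ D := by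
  have hg : (fun x : ℝ => (x : ℂ)).HasTemperateGrowth := by fun_prop
  set K₁ : 𝓢(ℝ, ℂ) := smulLeftCLM ℂ (fun x : ℝ => (x : ℂ)) K with hK₁d
  have hK₁ : ∀ v, K₁ v = v * K v := fun v => by
    rw [hK₁d, smulLeftCLM_apply_apply hg, smul_eq_mul]
  have hK₁S := fourier_mul_id_eq_zero hS hK hK₁
  refine ⟨C ^ 2 * (∫ v, ‖K v‖ ^ 2) + 2 * (C ^ 2 * ∫ v, ‖K₁ v‖ ^ 2) +
    2 * (C ^ 2 * ∫ v, ‖K v‖ ^ 2) + ∫ v : ℝ, (1 + v ^ 2)⁻¹, fun s b t h1 h2 => ?_⟩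
  have a1 := integral_norm_sq_sum_translates_le hK h1
  have a2 := integral_norm_sq_sum_translates_le hK h2
  have a3 := integral_norm_sq_sum_translates_le hK₁S h1
  have hint : ∀ (f : 𝓢(ℝ, ℂ)) (b : ℕ → ℝ),
      Integrable fun v => ‖∑ i ∈ s, (b i : ℂ) * f (v - t i)‖ ^ 2 := fun f b => by
    have e : ∀ v, ∑ i ∈ s, (b i : ℂ) * f (v - t i) =
        (∑ i ∈ s, (b i : ℂ) • f.compSubConstCLM ℂ (t i)) v := by
      intro v
      simp [sum_apply]
    simp_rw [e]
    exact ((∑ i ∈ s, (b i : ℂ) • f.compSubConstCLM ℂ (t i)).memLp 2).integrable_norm_pow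
      (by norm_num)
  have hint0 : Integrable fun v => ‖∑ i ∈ s, (b i : ℂ) * K (v - t i)‖ :=
    (integrable_finsetSum _ fun i _ => (K.integrable.comp_sub_right (t i)).const_mul _).norm
  have hinv : Integrable fun v : ℝ => (1 + v ^ 2)⁻¹ := integrable_inv_one_add_sq
  have hb : ∀ v : ℝ, ‖∑ i ∈ s, (b i : ℂ) * K (v - t i)‖ ≤
      ‖∑ i ∈ s, (b i : ℂ) * K (v - t i)‖ ^ 2 + 2 * ‖∑ i ∈ s, (b i : ℂ) * K₁ (v - t i)‖ ^ 2 +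
      2 * ‖∑ i ∈ s, ((b i * t i : ℝ) : ℂ) * K (v - t i)‖ ^ 2 + (1 + v ^ 2)⁻¹ := by
    intro v
    set x := ‖∑ i ∈ s, (b i : ℂ) * K (v - t i)‖ with hx
    set y := ‖∑ i ∈ s, (b i : ℂ) * K₁ (v - t i)‖ with hy
    set z := ‖∑ i ∈ s, ((b i * t i : ℝ) : ℂ) * K (v - t i)‖ with hz
    have hx0 : 0 ≤ x := norm_nonneg _
    -- From v K(v - t) = K₁(v - t) + t K(v - t). Thus multiplication by v costs the derivative of
    -- the exponential sum, which is the second hypothesis.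
    have e : |v| * x ≤ y + z := by
      have : (v : ℂ) * ∑ i ∈ s, (b i : ℂ) * K (v - t i) = ∑ i ∈ s, (b i : ℂ) * K₁ (v - t i) +
          ∑ i ∈ s, ((b i * t i : ℝ) : ℂ) * K (v - t i) := by
        rw [Finset.mul_sum, ← Finset.sum_add_distrib]
        refine Finset.sum_congr rfl fun i _ => ?_
        rw [hK₁]
        push_cast
        ring
      have h3 := norm_add_le (∑ i ∈ s, (b i : ℂ) * K₁ (v - t i))
        (∑ i ∈ s, ((b i * t i : ℝ) : ℂ) * K (v - t i))
      rwa [← this, norm_mul, Complex.norm_real, Real.norm_eq_abs] at h3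
    have e2 : v ^ 2 * x ^ 2 ≤ 2 * y ^ 2 + 2 * z ^ 2 := by
      have h4 : (|v| * x) ^ 2 ≤ (y + z) ^ 2 := pow_le_pow_left₀ (by positivity) e 2
      rw [mul_pow, sq_abs] at h4
      nlinarith [sq_nonneg (y - z)]
    have hpos : 0 < 1 + v ^ 2 := by positivity
    -- The passage from weighted L² to L¹, by the arithmetic–geometric mean inequality against the
    -- integrable weight 1/(1 + v²).
    have e3 : x ≤ (1 + v ^ 2) * x ^ 2 + (1 + v ^ 2)⁻¹ := by
      have hi : 0 < (1 + v ^ 2)⁻¹ := inv_pos.2 hpos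
      have h5 : (1 + v ^ 2) * (1 + v ^ 2)⁻¹ = 1 := mul_inv_cancel₀ hpos.ne'
      have h6 : 0 ≤ (1 + v ^ 2) * (x - (1 + v ^ 2)⁻¹) ^ 2 := by positivity
      have h7 : (1 + v ^ 2) * (x - (1 + v ^ 2)⁻¹) ^ 2 = (1 + v ^ 2) * x ^ 2 -
        2 * ((1 + v ^ 2) * (1 + v ^ 2)⁻¹) * x + ((1 + v ^ 2) * (1 + v ^ 2)⁻¹) * (1 + v ^ 2)⁻¹ := by
        ring
      rw [h7, h5] at h6
      linarith
    linarith
  refine (integral_mono hint0 ((((hint K b).add ((hint K₁ b).const_mul 2)).add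
    ((hint K _).const_mul 2)).add hinv) hb).trans ?_
  rw [integral_add' (((hint K b).add ((hint K₁ b).const_mul 2)).add ((hint K _).const_mul 2)) hinv,
    integral_add' ((hint K b).add ((hint K₁ b).const_mul 2)) ((hint K _).const_mul 2),
    integral_add' (hint K b) ((hint K₁ b).const_mul 2), integral_const_mul, integral_const_mul]
  linarith

/-! ### A Tauberian argument -/

lemma isClosed_frequencyBand (η R : ℝ) : IsClosed {ξ : ℝ | η ≤ |ξ| ∧ |ξ| ≤ R} :=
  (isClosed_le continuous_const continuous_abs).inter (isClosed_le continuous_abs continuous_const)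

lemma integrable_mul_logAverage {f : ℝ → ℂ} (hf : Integrable f) {F : ℕ → ℂ} {A : ℝ}
    (hF : ∀ n, ‖F n‖ ≤ A) {g : ℝ → ℝ} (hg : Measurable g) :
    Integrable fun v => f v * logAverage F (g v) :=
  hf.mul_bdd (c := A) ((measurable_logAverage F).comp hg).aestronglyMeasurable
    (ae_of_all _ fun _ => norm_logAverage_le hF _)

/-- Up to O(√L), L times the convolution is that of K * ν with the averages of F₁, where ν = ∑
(c_p/p) δ_{log p}. The L¹ norm of K * ν is bounded independently of L, so dividing by L leaves
O(1/√L), with L arbitrary. -/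
theorem tendsto_convolution_logAverage (q : ℕ) [NeZero q] {F₀ F₁ : ℕ → ℂ} {A : ℝ}
    (hF₀ : ∀ n, ‖F₀ n‖ ≤ A) (hF₁ : ∀ n, ‖F₁ n‖ ≤ A)
    (hF : ∀ p : ℕ, p.Prime → (p : ZMod q) = 1 → ∀ n, 1 ≤ n → F₀ (p * n) = F₁ n)
    {η R : ℝ} (hη : 0 < η) {K : 𝓢(ℝ, ℂ)}
    (hK : ∀ ξ, ξ ∉ {ξ : ℝ | η ≤ |ξ| ∧ |ξ| ≤ R} → 𝓕 K ξ = 0) :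
    Tendsto (fun u => ∫ v, K v * logAverage F₀ (u - v)) atTop (𝓝 0) := by
  have hA : 0 ≤ A := (norm_nonneg _).trans (hF₀ 0)
  obtain ⟨C, hC⟩ := exists_weighted_primes q hη R
  obtain ⟨D, hD⟩ := exists_integral_norm_sum_translates_le (isClosed_frequencyBand η R) hK C
  set k := ∫ v, ‖K v‖ with hk
  have hk0 : 0 ≤ k := integral_nonneg fun _ => norm_nonneg _
  set M := A * |D| + 1 + k * A with hM
  have hM0 : 0 < M := by positivity
  rw [Metric.tendsto_atTop]
  intro ε hε
  obtain ⟨B, c, hB, hc, hL, hξ⟩ := hC ((M / ε + 1) ^ 2)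
  set L := ∑ p ∈ B, c p / p with hLdef
  have hLs : M / ε + 1 ≤ √L := Real.le_sqrt_of_sq_le hL
  have hMε : 0 < M / ε := by positivity
  have hs0 : 0 < √L := by linarith
  have hL0 : 0 < L := Real.sqrt_pos.1 hs0
  have hLsq : √L * √L = L := Real.mul_self_sqrt hL0.le
  set S : ℝ → ℂ := fun u => ∑ p ∈ B, ((c p / p : ℝ) : ℂ) * logAverage F₁ (u - Real.log p) with hS
  have hSint : ∀ u, Integrable fun v => K v * S (u - v) := by
    intro u
    simp only [hS, Finset.mul_sum]
    refine integrable_finsetSum _ fun p _ => ?_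
    simp_rw [mul_left_comm]
    exact (integrable_mul_logAverage K.integrable hF₁ (by fun_prop)).const_mul _
  have hSbound : ∀ u, ‖S u‖ ≤ A * L := by
    intro u
    refine (norm_sum_le _ _).trans ?_
    rw [hLdef, Finset.mul_sum]
    refine Finset.sum_le_sum fun p _ => ?_
    have : 0 ≤ c p / p := div_nonneg (hc p).1 (Nat.cast_nonneg p)
    rw [norm_mul, Complex.norm_real, Real.norm_of_nonneg this, mul_comm]
    exact mul_le_mul_of_nonneg_right (norm_logAverage_le hF₁ _) this
  -- The translations by log p are moved from the averages onto K.
  have hmain : ∀ u, ‖∫ v, K v * S (u - v)‖ ≤ A * D := by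
    intro u
    have e : ∫ v, K v * S (u - v) =
        ∫ v, (∑ p ∈ B, ((c p / p : ℝ) : ℂ) * K (v - Real.log p)) * logAverage F₁ (u - v) := by
      simp only [hS, Finset.mul_sum, Finset.sum_mul]
      rw [integral_finsetSum, integral_finsetSum]
      · refine Finset.sum_congr rfl fun p _ => ?_
        rw [← integral_sub_right_eq_self _ (Real.log p)]
        refine integral_congr_ae (ae_of_all _ fun v => ?_)
        simp only
        rw [sub_sub, sub_add_cancel]
        ring
      · intro p _
        exact integrable_mul_logAverage ((K.integrable.comp_sub_right _).const_mul _) hF₁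
          (by fun_prop)
      · intro p _
        simp_rw [mul_left_comm (K _)]
        exact (integrable_mul_logAverage K.integrable hF₁ (by fun_prop)).const_mul _
    rw [e]
    have hi : Integrable fun v => ∑ p ∈ B, ((c p / p : ℝ) : ℂ) * K (v - Real.log p) :=
      integrable_finsetSum _ fun p _ => (K.integrable.comp_sub_right _).const_mul _
    refine (norm_integral_le_integral_norm _).trans ?_
    have h1 := hD B (fun p => c p / p) (fun p => Real.log p) (fun ξ h => (hξ ξ h.1 h.2).1)
      (fun ξ h => (hξ ξ h.1 h.2).2)
    refine le_trans ?_ (mul_le_mul_of_nonneg_left h1 hA)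
    rw [← integral_const_mul]
    refine integral_mono (integrable_mul_logAverage hi hF₁ (by fun_prop)).norm
      (hi.norm.const_mul _) fun v => ?_
    simp only
    rw [norm_mul, mul_comm]
    exact mul_le_mul_of_nonneg_right (norm_logAverage_le hF₁ _) (norm_nonneg _)
  -- The error e^{-u/2} blows up as u → -∞, where the convolution also samples it; the minimum with
  -- the trivial bound gives a majorant for dominated convergence.
  set m : ℝ → ℝ := fun u => min (2 * (A * L)) (A * (2 * B.card) * Real.exp (-u / 2)) with hm
  have hm0 : ∀ u, 0 ≤ m u := fun u => le_min (by positivity) (by positivity)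
  have hmmeas : Measurable m := by fun_prop
  have hE : ∀ u, ‖(L : ℂ) * logAverage F₀ u - S u‖ ≤ A * √L + m u := by
    intro u
    rw [hm, ← min_add_add_left]
    refine le_min ?_ ?_
    · refine (norm_sub_le _ _).trans ?_
      rw [norm_mul, Complex.norm_real, Real.norm_of_nonneg hL0.le]
      have h1 := mul_le_mul_of_nonneg_left (norm_logAverage_le hF₀ u) hL0.le
      have h2 := hSbound u
      have h3 : 0 ≤ A * √L := by positivity
      linarith
    · exact norm_logAverage_dilate_le (fun p hp => (hB p hp).1) hc hF₀
        (fun p hp => hF p (hB p hp).1 (hB p hp).2) u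
  have hmint : ∀ u, Integrable fun v => ‖K v‖ * m (u - v) := fun u =>
    K.integrable.norm.mul_bdd (c := 2 * (A * L))
      (hmmeas.comp (by fun_prop)).aestronglyMeasurable
      (ae_of_all _ fun v => by
        rw [Real.norm_of_nonneg (hm0 _)]; exact min_le_left _ _)
  have hmlim : Tendsto (fun u => ∫ v, ‖K v‖ * m (u - v)) atTop (𝓝 0) := by
    rw [← integral_zero ℝ ℝ (μ := volume)]
    refine tendsto_integral_filter_of_dominated_convergence (fun v => ‖K v‖ * (2 * (A * L)))
      (Eventually.of_forall fun u => (hmint u).aestronglyMeasurable)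
      (Eventually.of_forall fun u => ae_of_all _ fun v => ?_)
      (K.integrable.norm.mul_const _) (ae_of_all _ fun v => ?_)
    · rw [norm_mul, norm_norm, Real.norm_of_nonneg (hm0 _)]
      exact mul_le_mul_of_nonneg_left (min_le_left _ _) (norm_nonneg _)
    · rw [← mul_zero ‖K v‖]
      refine Tendsto.const_mul _ ?_
      refine squeeze_zero (fun u => hm0 _) (fun u => min_le_right _ _) ?_
      rw [← mul_zero (A * (2 * B.card))]
      refine Tendsto.const_mul _ (Real.tendsto_exp_atBot.comp ?_)
      have : Tendsto (fun u : ℝ => u - v) atTop atTop :=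
        tendsto_atTop_add_const_right _ _ tendsto_id
      exact (tendsto_neg_atTop_atBot.comp this).atBot_div_const two_pos
  obtain ⟨u₀, hu₀⟩ := eventually_atTop.1 (hmlim.eventually (gt_mem_nhds one_pos))
  refine ⟨u₀, fun u hu => ?_⟩
  rw [dist_zero_right]
  have hGint : Integrable fun v => K v * logAverage F₀ (u - v) :=
    integrable_mul_logAverage K.integrable hF₀ (by fun_prop)
  have e : (L : ℂ) * ∫ v, K v * logAverage F₀ (u - v) = (∫ v, K v * S (u - v)) +
      ∫ v, K v * ((L : ℂ) * logAverage F₀ (u - v) - S (u - v)) := by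
    rw [← integral_const_mul, ← integral_add (hSint u)]
    · refine integral_congr_ae (ae_of_all _ fun v => ?_)
      simp only
      ring
    · have := (hGint.const_mul (L : ℂ)).sub (hSint u)
      refine this.congr (ae_of_all _ fun v => ?_)
      simp only [Pi.sub_apply]
      ring
  have hbound : L * ‖∫ v, K v * logAverage F₀ (u - v)‖ ≤ A * D + (k * (A * √L) + 1) := by
    have h1 : ‖(L : ℂ) * ∫ v, K v * logAverage F₀ (u - v)‖ =
        L * ‖∫ v, K v * logAverage F₀ (u - v)‖ := by
      rw [norm_mul, Complex.norm_real, Real.norm_of_nonneg hL0.le]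
    rw [← h1, e]
    refine (norm_add_le _ _).trans (add_le_add (hmain u) ?_)
    have h2 : ‖∫ v, K v * ((L : ℂ) * logAverage F₀ (u - v) - S (u - v))‖ ≤
        ∫ v, (‖K v‖ * (A * √L) + ‖K v‖ * m (u - v)) := by
      refine norm_integral_le_of_norm_le ((K.integrable.norm.mul_const _).add (hmint u))
        (ae_of_all _ fun v => ?_)
      rw [norm_mul, ← mul_add]
      exact mul_le_mul_of_nonneg_left (hE _) (norm_nonneg _)
    rw [integral_add (K.integrable.norm.mul_const _) (hmint u), integral_mul_const] at h2
    exact h2.trans (add_le_add le_rfl (hu₀ u hu).le)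
  have hs1 : 1 ≤ √L := by linarith
  have h3 : A * D + (k * (A * √L) + 1) ≤ M * √L := by
    have : A * D ≤ A * |D| * √L :=
      (mul_le_mul_of_nonneg_left (le_abs_self D) hA).trans
        (le_mul_of_one_le_right (by positivity) hs1)
    rw [hM]
    nlinarith
  have h4 : √L * ‖∫ v, K v * logAverage F₀ (u - v)‖ ≤ M := by
    refine le_of_mul_le_mul_left ?_ hs0
    rw [← mul_assoc, hLsq, mul_comm _ M]
    exact hbound.trans h3
  have h5 : M < ε * √L := by
    rw [← div_lt_iff₀' hε]
    linarith
  nlinarith [norm_nonneg (∫ v, K v * logAverage F₀ (u - v))]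

/-! ### Rescaled kernels and asymptotic translation invariance -/

/-- The rescaling `v ↦ l φ (l v)` of a Schwartz function. -/
noncomputable def SchwartzMap.rescale (l : ℝˣ) (φ : 𝓢(ℝ, ℂ)) : 𝓢(ℝ, ℂ) :=
  ((l : ℝ) : ℂ) • compCLMOfContinuousLinearEquiv ℂ (ContinuousLinearEquiv.unitsEquivAut ℝ l) φ

lemma SchwartzMap.rescale_apply (l : ℝˣ) (φ : 𝓢(ℝ, ℂ)) (v : ℝ) :
    φ.rescale l v = (l : ℝ) * φ (l * v) := by
  simp [rescale, mul_comm]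

lemma SchwartzMap.integral_rescale_smul (l : ℝˣ) (hl : 0 < (l : ℝ)) (φ : 𝓢(ℝ, ℂ)) (g : ℝ → ℂ) :
    ∫ v, φ.rescale l v * g v = ∫ w, φ w * g (w / l) := by
  have h := Measure.integral_comp_mul_left (fun w => φ w * g (w / l)) (l : ℝ)
  have e : ∀ v : ℝ, φ.rescale l v * g v = ((l : ℝ) : ℂ) * (φ (l * v) * g (l * v / l)) := by
    intro v
    rw [rescale_apply, mul_div_cancel_left₀ _ hl.ne', mul_assoc]
  simp_rw [e]
  rw [integral_const_mul, h, abs_of_pos (inv_pos.2 hl), Complex.real_smul, ← mul_assoc,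
    ← Complex.ofReal_mul, mul_inv_cancel₀ hl.ne', Complex.ofReal_one, one_mul]

lemma SchwartzMap.fourier_rescale (l : ℝˣ) (hl : 0 < (l : ℝ)) (φ : 𝓢(ℝ, ℂ)) (ξ : ℝ) :
    𝓕 (φ.rescale l) ξ = 𝓕 φ (ξ / l) := by
  rw [fourier_coe, fourier_coe, Real.fourier_real_eq, Real.fourier_real_eq]
  simp only [Circle.smul_def, smul_eq_mul]
  simp_rw [mul_comm _ (φ.rescale l _), mul_comm _ (φ _)]
  rw [integral_rescale_smul l hl φ fun v => (Real.fourierChar (-(v * ξ)) : ℂ)]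
  refine integral_congr_ae (ae_of_all _ fun w => ?_)
  simp only
  rw [div_mul_eq_mul_div, mul_div_assoc]

lemma SchwartzMap.exists_norm_comp_sub_le (φ : 𝓢(ℝ, ℂ)) :
    ∃ C : ℝ, ∀ s : ℝ, |s| ≤ 1 → ∀ w : ℝ, ‖φ (w - s)‖ ≤ C * (1 + w ^ 2)⁻¹ := by
  obtain ⟨C₀, h₀⟩ := φ.decay 0 0
  obtain ⟨C₂, h₂⟩ := φ.decay 2 0
  simp only [norm_iteratedFDeriv_zero, pow_zero, one_mul, Real.norm_eq_abs, sq_abs] at h₀ h₂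
  refine ⟨3 * (C₀ + C₂), fun s hs w => ?_⟩
  have hpos : 0 < 1 + w ^ 2 := by positivity
  rw [← div_eq_mul_inv, le_div_iff₀ hpos]
  have h1 := h₀.2 (w - s)
  have h2 := h₂.2 (w - s)
  have hs2 : s ^ 2 ≤ 1 := by rw [← sq_abs]; exact pow_le_one₀ (abs_nonneg s) hs
  have h3 : 1 + w ^ 2 ≤ 3 * (1 + (w - s) ^ 2) := by nlinarith [sq_nonneg (w - 2 * s)]
  have h4 := mul_le_mul_of_nonneg_left h3 (norm_nonneg (φ (w - s)))
  nlinarith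

lemma SchwartzMap.tendsto_integral_norm_comp_sub_sub (φ : 𝓢(ℝ, ℂ)) :
    Tendsto (fun s : ℝ => ∫ w, ‖φ (w - s) - φ w‖) (𝓝 0) (𝓝 0) := by
  obtain ⟨C, hC⟩ := φ.exists_norm_comp_sub_le
  suffices h : Tendsto (fun s : ℝ => ∫ w, ‖φ (w - s) - φ w‖) (𝓝 0) (𝓝 (∫ _ : ℝ, (0 : ℝ))) by
    rwa [integral_zero] at h
  refine tendsto_integral_filter_of_dominated_convergence (fun w => 2 * (C * (1 + w ^ 2)⁻¹))
    (Eventually.of_forall fun s => by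
      have := φ.continuous
      exact Continuous.aestronglyMeasurable (by fun_prop)) ?_
    ((integrable_inv_one_add_sq.const_mul C).const_mul 2) (ae_of_all _ fun w => ?_)
  · have h1 : ∀ᶠ s : ℝ in 𝓝 0, |s| ≤ 1 := by
      filter_upwards [Metric.ball_mem_nhds (0 : ℝ) one_pos] with s hs
      rw [Metric.mem_ball, dist_zero_right, Real.norm_eq_abs] at hs
      exact hs.le
    filter_upwards [h1] with s hs
    refine ae_of_all _ fun w => ?_
    rw [norm_norm]
    have h2 := hC 0 (by simp) w
    rw [sub_zero] at h2
    linarith [norm_sub_le (φ (w - s)) (φ w), hC s hs w]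
  · have hcont : Continuous fun s : ℝ => ‖φ (w - s) - φ w‖ := by
      have := φ.continuous
      fun_prop
    simpa using hcont.tendsto 0

lemma exists_schwartz_fourier_bump : ∃ φ : 𝓢(ℝ, ℂ), (∀ ξ : ℝ, |ξ| ≤ 1 → 𝓕 φ ξ = 1) ∧
    ∀ ξ : ℝ, 2 ≤ |ξ| → 𝓕 φ ξ = 0 := by
  let b : ContDiffBump (0 : ℝ) := ⟨1, 2, one_pos, one_lt_two⟩
  have h1 : HasCompactSupport fun ξ => (b ξ : ℂ) :=
    b.hasCompactSupport.comp_left (g := fun x : ℝ => (x : ℂ)) Complex.ofReal_zero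
  have h2 : ContDiff ℝ (⊤ : ℕ∞) fun ξ => (b ξ : ℂ) :=
    Complex.ofRealCLM.contDiff.comp b.contDiff
  refine ⟨𝓕⁻ (h1.toSchwartzMap h2), fun ξ hξ => ?_, fun ξ hξ => ?_⟩
  · rw [FourierTransform.fourier_fourierInv_eq, HasCompactSupport.toSchwartzMap_toFun,
      b.one_of_mem_closedBall (by simpa using hξ), Complex.ofReal_one]
  · rw [FourierTransform.fourier_fourierInv_eq, HasCompactSupport.toSchwartzMap_toFun,
      b.zero_of_le_dist (by simpa using hξ), Complex.ofReal_zero]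

/-- If the convolutions of `logAverage F` with all kernels band-limited away from `0` tend to `0`,
then `logAverage F` is asymptotically invariant under translations. -/
theorem tendsto_logAverage_sub_translate {F : ℕ → ℂ} {A : ℝ} (hF : ∀ n, ‖F n‖ ≤ A)
    (hconv : ∀ (η R : ℝ) (K : 𝓢(ℝ, ℂ)), 0 < η →
      (∀ ξ, ξ ∉ {ξ : ℝ | η ≤ |ξ| ∧ |ξ| ≤ R} → 𝓕 K ξ = 0) →
      Tendsto (fun u => ∫ v, K v * logAverage F (u - v)) atTop (𝓝 0)) (t : ℝ) :
    Tendsto (fun u => logAverage F (u - t) - logAverage F u) atTop (𝓝 0) := by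
  have hA : 0 ≤ A := (norm_nonneg _).trans (hF 0)
  obtain ⟨φ, hφ1, hφ2⟩ := exists_schwartz_fourier_bump
  have hφint : ∫ w, φ w = 1 := by
    have := hφ1 0 (by simp)
    rw [fourier_coe, Real.fourier_real_eq] at this
    simpa using this
  set N := ∫ w, ‖φ w‖ with hN
  set N₁ := ∫ w, ‖w‖ ^ 1 * ‖φ w‖ with hN₁
  have hN0 : 0 ≤ N := integral_nonneg fun _ => norm_nonneg _
  have hN₁0 : 0 ≤ N₁ := integral_nonneg fun _ => by positivity
  have hint1 : Integrable fun w : ℝ => ‖w‖ ^ 1 * ‖φ w‖ := φ.integrable_pow_mul volume 1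
  rw [Metric.tendsto_atTop]
  intro ε hε
  -- the fine scale
  obtain ⟨l, hl1, hl⟩ : ∃ l : ℝ, 1 ≤ l ∧ 2 * A * N₁ / l ≤ ε / 12 := by
    refine ⟨max 1 (2 * A * N₁ / (ε / 12)), le_max_left _ _, ?_⟩
    rw [div_le_iff₀ (by positivity), ← div_le_iff₀' (by positivity)]
    exact le_max_right _ _
  have hl0 : 0 < l := by linarith
  -- the coarse scale
  obtain ⟨s, hs0, hs1, hs⟩ : ∃ s : ℝ, 0 < s ∧ s ≤ 1 ∧
      A * ∫ w, ‖φ (w - s * t) - φ w‖ ≤ ε / 6 := by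
    have h1 : Tendsto (fun s : ℝ => A * ∫ w, ‖φ (w - s * t) - φ w‖) (𝓝[>] 0) (𝓝 (A * 0)) := by
      refine Tendsto.const_mul A (φ.tendsto_integral_norm_comp_sub_sub.comp ?_)
      have : Tendsto (fun s : ℝ => s * t) (𝓝 0) (𝓝 (0 * t)) := (continuous_mul_const t).tendsto 0
      rw [zero_mul] at this
      exact this.mono_left nhdsWithin_le_nhds
    rw [mul_zero] at h1
    have h2 := h1.eventually (gt_mem_nhds (by positivity : 0 < ε / 6))
    have h3 : ∀ᶠ s : ℝ in 𝓝[>] 0, s ∈ Set.Ioo (0 : ℝ) 1 := Ioo_mem_nhdsGT one_pos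
    obtain ⟨s, h4, h5⟩ := (h2.and h3).exists
    exact ⟨s, h5.1, h5.2.le, h4.le⟩
  set l' : ℝˣ := Units.mk0 l hl0.ne' with hl'
  set s' : ℝˣ := Units.mk0 s hs0.ne' with hs'
  set P : 𝓢(ℝ, ℂ) := φ.rescale l' with hP
  set Q : 𝓢(ℝ, ℂ) := φ.rescale s' with hQ
  have hPint : ∀ u, Integrable fun v => P v * logAverage F (u - v) := fun u =>
    integrable_mul_logAverage P.integrable hF (by fun_prop)
  have hQint : ∀ u, Integrable fun v => Q v * logAverage F (u - v) := fun u =>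
    integrable_mul_logAverage Q.integrable hF (by fun_prop)
  -- The transforms of P and Q are both 1 for |ξ| ≤ s and both 0 for |ξ| ≥ 2l, so P - Q is
  -- band-limited away from 0 and `hconv` applies.
  have hPQ : Tendsto (fun u => (∫ v, P v * logAverage F (u - v)) -
      ∫ v, Q v * logAverage F (u - v)) atTop (𝓝 0) := by
    have h := hconv s (2 * l) (P - Q) hs0 ?_
    · refine h.congr fun u => ?_
      rw [← integral_sub (hPint u) (hQint u)]
      refine integral_congr_ae (ae_of_all _ fun v => ?_)
      simp only [sub_apply, sub_mul]
    · intro ξ hξ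
      have e : 𝓕 (P - Q) ξ = 𝓕 φ (ξ / l) - 𝓕 φ (ξ / s) := by
        rw [← fourierTransformCLM_apply ℂ, map_sub, sub_apply, fourierTransformCLM_apply,
          fourierTransformCLM_apply, hP, hQ, fourier_rescale l' hl0, fourier_rescale s' hs0]
        rfl
      rw [e]
      have hal : |ξ / l| = |ξ| / l := by rw [abs_div, abs_of_pos hl0]
      have has : |ξ / s| = |ξ| / s := by rw [abs_div, abs_of_pos hs0]
      rw [Set.mem_ofPred_eq, not_and_or, not_le, not_le] at hξ
      rcases hξ with h | h
      · rw [hφ1 _ (by rw [hal, div_le_one hl0]; linarith),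
          hφ1 _ (by rw [has, div_le_one hs0]; linarith), sub_self]
      · rw [hφ2 _ (by rw [hal, le_div_iff₀ hl0]; linarith),
          hφ2 _ (by rw [has, le_div_iff₀ hs0]; nlinarith), sub_self]
  -- P has mass 1 concentrated at scale 1/l, so slow oscillation makes smoothing by P nearly the
  -- identity.
  have hfine : ∀ u, ‖(∫ v, P v * logAverage F (u - v)) - logAverage F u‖ ≤
      ε / 12 + A * N * Real.exp (-u) := by
    intro u
    have e : (∫ v, P v * logAverage F (u - v)) - logAverage F u =
        ∫ w, φ w * (logAverage F (u - w / l) - logAverage F u) := by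
      rw [hP, integral_rescale_smul l' hl0 φ fun v => logAverage F (u - v)]
      have h1 : logAverage F u = ∫ w, φ w * logAverage F u := by
        rw [integral_mul_const, hφint, one_mul]
      rw [h1, ← integral_sub (integrable_mul_logAverage φ.integrable hF (by fun_prop))
        (φ.integrable.mul_const _), ← h1]
      refine integral_congr_ae (ae_of_all _ fun v => ?_)
      simp only [mul_sub]
      rfl
    rw [e]
    have hg : Integrable fun w => 2 * A / l * (‖w‖ ^ 1 * ‖φ w‖) + ‖φ w‖ * (A * Real.exp (-u)) :=
      (hint1.const_mul _).add (φ.integrable.norm.mul_const _)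
    refine (norm_integral_le_of_norm_le hg (ae_of_all _ fun w => ?_)).trans ?_
    · rw [norm_mul, norm_sub_rev]
      have h1 := mul_le_mul_of_nonneg_left (norm_logAverage_sub_le hF u (u - w / l))
        (norm_nonneg (φ w))
      refine h1.trans (le_of_eq ?_)
      rw [sub_sub_cancel, abs_div, abs_of_pos hl0, Real.norm_eq_abs]
      ring
    · rw [integral_add (hint1.const_mul _) (φ.integrable.norm.mul_const _), integral_const_mul,
        integral_mul_const]
      have : 2 * A / l * N₁ = 2 * A * N₁ / l := by ring
      rw [← hN₁, ← hN, this]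
      linarith
  -- Q has width about 1/s, so translating by t amounts to translating φ by the small amount st,
  -- which is negligible in L¹.
  have hcoarse : ∀ u, ‖(∫ v, Q v * logAverage F (u - t - v)) - ∫ v, Q v * logAverage F (u - v)‖ ≤
      ε / 6 := by
    intro u
    have e1 : ∫ v, Q v * logAverage F (u - t - v) = ∫ w, φ (w - s * t) * logAverage F (u - w / s) := by
      rw [hQ, integral_rescale_smul s' hs0 φ fun v => logAverage F (u - t - v),
        ← integral_sub_right_eq_self _ (s * t)]
      refine integral_congr_ae (ae_of_all _ fun w => ?_)
      have : u - t - (w - s * t) / s = u - w / s := by field_simp; ring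
      simp only [hs', Units.val_mk0]
      rw [this]
    have e2 : ∫ v, Q v * logAverage F (u - v) = ∫ w, φ w * logAverage F (u - w / s) := by
      rw [hQ, integral_rescale_smul s' hs0 φ fun v => logAverage F (u - v)]
      rfl
    have hi1 : Integrable fun w => φ (w - s * t) := φ.integrable.comp_sub_right _
    rw [e1, e2, ← integral_sub (integrable_mul_logAverage hi1 hF (by fun_prop))
      (integrable_mul_logAverage φ.integrable hF (by fun_prop))]
    refine le_trans ?_ hs
    rw [← integral_const_mul]
    refine norm_integral_le_of_norm_le ((hi1.sub φ.integrable).norm.const_mul A)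
      (ae_of_all _ fun w => ?_)
    rw [← sub_mul, norm_mul, mul_comm]
    exact mul_le_mul_of_nonneg_right (norm_logAverage_le hF _) (norm_nonneg _)
  have hshift : Tendsto (fun u : ℝ => u - t) atTop atTop :=
    tendsto_atTop_add_const_right _ _ tendsto_id
  have hexp : Tendsto (fun u : ℝ => A * N * Real.exp (-u)) atTop (𝓝 0) := by
    rw [← mul_zero (A * N)]
    exact (Real.tendsto_exp_neg_atTop_nhds_zero).const_mul _
  have hε12 : 0 < ε / 12 := by positivity
  have hev1 := hexp.eventually (gt_mem_nhds hε12)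
  have hev2 := (Metric.tendsto_nhds.1 hPQ) (ε / 12) hε12
  obtain ⟨u₀, hu₀⟩ := eventually_atTop.1 (hev1.and hev2)
  refine ⟨max u₀ (u₀ + t), fun u hu => ?_⟩
  rw [dist_zero_right]
  obtain ⟨b1, b2⟩ := hu₀ u ((le_max_left _ _).trans hu)
  obtain ⟨b3, b4⟩ := hu₀ (u - t) (by linarith [(le_max_right _ _).trans hu])
  rw [dist_zero_right] at b2 b4
  have f1 := hfine u
  have f2 := hfine (u - t)
  have f3 := hcoarse u
  rw [norm_sub_rev] at f2 b2
  -- Pass from u - t to u through the chain average, P, Q, Q, P, average. The five errors add up to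
  -- at most 2ε/3.
  have key : logAverage F (u - t) - logAverage F u =
      (logAverage F (u - t) - ∫ v, P v * logAverage F (u - t - v)) +
      ((∫ v, P v * logAverage F (u - t - v)) - ∫ v, Q v * logAverage F (u - t - v)) +
      ((∫ v, Q v * logAverage F (u - t - v)) - ∫ v, Q v * logAverage F (u - v)) +
      ((∫ v, Q v * logAverage F (u - v)) - ∫ v, P v * logAverage F (u - v)) +
      ((∫ v, P v * logAverage F (u - v)) - logAverage F u) := by ring
  rw [key]
  refine (norm_add_le _ _).trans_lt ?_
  have g1 := norm_add_le ((logAverage F (u - t) - ∫ v, P v * logAverage F (u - t - v)) +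
      ((∫ v, P v * logAverage F (u - t - v)) - ∫ v, Q v * logAverage F (u - t - v)) +
      ((∫ v, Q v * logAverage F (u - t - v)) - ∫ v, Q v * logAverage F (u - v)))
      ((∫ v, Q v * logAverage F (u - v)) - ∫ v, P v * logAverage F (u - v))
  have g2 := norm_add_le ((logAverage F (u - t) - ∫ v, P v * logAverage F (u - t - v)) +
      ((∫ v, P v * logAverage F (u - t - v)) - ∫ v, Q v * logAverage F (u - t - v)))
      ((∫ v, Q v * logAverage F (u - t - v)) - ∫ v, Q v * logAverage F (u - v))
  have g3 := norm_add_le (logAverage F (u - t) - ∫ v, P v * logAverage F (u - t - v))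
      ((∫ v, P v * logAverage F (u - t - v)) - ∫ v, Q v * logAverage F (u - t - v))
  linarith

/-- F₂ is there because the translation invariance of the averages of F₁ is obtained from the
dilates of F₁ itself. Given that invariance, every translate in the Turán–Kubilius comparison of F₀
with F₁ can be replaced by the untranslated average. -/
theorem tendsto_logAverage_sub_logAverage (q : ℕ) [NeZero q] {F₀ F₁ F₂ : ℕ → ℂ} {A : ℝ}
    (hF₀ : ∀ n, ‖F₀ n‖ ≤ A) (hF₁ : ∀ n, ‖F₁ n‖ ≤ A) (hF₂ : ∀ n, ‖F₂ n‖ ≤ A)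
    (h₀₁ : ∀ p : ℕ, p.Prime → (p : ZMod q) = 1 → ∀ n, 1 ≤ n → F₀ (p * n) = F₁ n)
    (h₁₂ : ∀ p : ℕ, p.Prime → (p : ZMod q) = 1 → ∀ n, 1 ≤ n → F₁ (p * n) = F₂ n) :
    Tendsto (fun u => logAverage F₀ u - logAverage F₁ u) atTop (𝓝 0) := by
  have hA : 0 ≤ A := (norm_nonneg _).trans (hF₀ 0)
  have hinv := tendsto_logAverage_sub_translate hF₁ fun η R K hη hK =>
    tendsto_convolution_logAverage q hF₁ hF₂ h₁₂ hη hK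
  -- Only the large mass L matters here; the frequency band is arbitrary.
  obtain ⟨C, hC⟩ := exists_weighted_primes q one_pos 1
  rw [Metric.tendsto_atTop]
  intro ε hε
  obtain ⟨B, c, hB, hc, hL, -⟩ := hC (((A + 2) / ε + 1) ^ 2)
  set L := ∑ p ∈ B, c p / p with hLdef
  have hLs : (A + 2) / ε + 1 ≤ √L := Real.le_sqrt_of_sq_le hL
  have hMε : 0 < (A + 2) / ε := by positivity
  have hs0 : 0 < √L := by linarith
  have hL0 : 0 < L := Real.sqrt_pos.1 hs0
  have hLsq : √L * √L = L := Real.mul_self_sqrt hL0.le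
  have hlim : Tendsto (fun u => ∑ p ∈ B, ((c p / p : ℝ) : ℂ) *
      (logAverage F₁ (u - Real.log p) - logAverage F₁ u)) atTop (𝓝 0) := by
    have := tendsto_finsetSum B fun p _ => (hinv (Real.log p)).const_mul ((c p / p : ℝ) : ℂ)
    simpa only [mul_zero, Finset.sum_const_zero] using this
  have hexp : Tendsto (fun u : ℝ => A * (2 * B.card) * Real.exp (-u / 2)) atTop (𝓝 0) := by
    rw [← mul_zero (A * (2 * B.card))]
    refine Tendsto.const_mul _ (Real.tendsto_exp_atBot.comp ?_)
    exact tendsto_neg_atTop_atBot.atBot_div_const two_pos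
  obtain ⟨u₀, hu₀⟩ := eventually_atTop.1 ((hexp.eventually (gt_mem_nhds one_pos)).and
    ((Metric.tendsto_nhds.1 hlim) 1 one_pos))
  refine ⟨u₀, fun u hu => ?_⟩
  obtain ⟨b1, b2⟩ := hu₀ u hu
  rw [dist_zero_right] at b2 ⊢
  have b3 := norm_logAverage_dilate_le (fun p hp => (hB p hp).1) hc hF₀
    (fun p hp => h₀₁ p (hB p hp).1 (hB p hp).2) u
  rw [← hLdef] at b3
  have e : (L : ℂ) * (logAverage F₀ u - logAverage F₁ u) =
      ((L : ℂ) * logAverage F₀ u -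
        ∑ p ∈ B, ((c p / p : ℝ) : ℂ) * logAverage F₁ (u - Real.log p)) +
      ∑ p ∈ B, ((c p / p : ℝ) : ℂ) * (logAverage F₁ (u - Real.log p) - logAverage F₁ u) := by
    simp_rw [mul_sub]
    rw [Finset.sum_sub_distrib, ← Finset.sum_mul, ← Complex.ofReal_sum, ← hLdef]
    ring
  have h1 : L * ‖logAverage F₀ u - logAverage F₁ u‖ ≤ A * √L + 2 := by
    have h2 : ‖(L : ℂ) * (logAverage F₀ u - logAverage F₁ u)‖ =
        L * ‖logAverage F₀ u - logAverage F₁ u‖ := by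
      rw [norm_mul, Complex.norm_real, Real.norm_of_nonneg hL0.le]
    rw [← h2, e]
    refine (norm_add_le _ _).trans ?_
    linarith
  have hs1 : 1 ≤ √L := by linarith
  have h4 : √L * ‖logAverage F₀ u - logAverage F₁ u‖ ≤ A + 2 := by
    refine le_of_mul_le_mul_left ?_ hs0
    rw [← mul_assoc, hLsq]
    nlinarith
  have h5 : A + 2 < ε * √L := by
    rw [← div_lt_iff₀' hε]
    linarith
  nlinarith [norm_nonneg (logAverage F₀ u - logAverage F₁ u)]

lemma logAverage_log {F : ℕ → ℂ} {N : ℕ} (hN : 1 ≤ N) :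
    logAverage F (Real.log N) = cesaroAverage F N := by
  have h0 : (0 : ℝ) < N := by exact_mod_cast hN
  rw [logAverage, cesaroAverage, Real.exp_neg, Real.exp_log h0, Nat.floor_natCast]
  push_cast
  rw [one_div]

/-- If `w` is invariant under multiplication by primes `p ≡ 1` mod `q`, then the averages of
`w n * a (Ω n)` do not change when `a` is shifted. -/
theorem tendsto_cesaroAverage_shift_Omega (q : ℕ) [NeZero q] {w a : ℕ → ℂ} {A W : ℝ}
    (ha : ∀ k, ‖a k‖ ≤ A) (hw : ∀ n, ‖w n‖ ≤ W)
    (hwp : ∀ p : ℕ, p.Prime → (p : ZMod q) = 1 → ∀ n, w (p * n) = w n) :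
    Tendsto (cesaroAverage fun n => w n * (a (Ω n) - a (Ω n + 1))) atTop (𝓝 0) := by
  have hW : 0 ≤ W := (norm_nonneg _).trans (hw 0)
  have hb : ∀ k n, ‖w n * a (Ω n + k)‖ ≤ W * A := fun k n => by
    rw [norm_mul]
    exact mul_le_mul (hw n) (ha _) (norm_nonneg _) hW
  have hstep : ∀ k (p : ℕ), p.Prime → (p : ZMod q) = 1 → ∀ n, 1 ≤ n →
      w (p * n) * a (Ω (p * n) + k) = w n * a (Ω n + (k + 1)) := by
    intro k p hp hp1 n hn
    rw [hwp p hp hp1, ArithmeticFunction.cardFactors_mul hp.ne_zero (by omega),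
      ArithmeticFunction.cardFactors_apply_prime hp]
    congr 2
    ring
  have h := (tendsto_logAverage_sub_logAverage q (F₀ := fun n => w n * a (Ω n + 0))
    (hb 0) (hb 1) (hb 2) (hstep 0) (hstep 1)).comp
    (Real.tendsto_log_atTop.comp tendsto_natCast_atTop_atTop)
  refine h.congr' ?_
  filter_upwards [eventually_ge_atTop 1] with N hN
  simp only [Function.comp_apply]
  rw [logAverage_log hN, logAverage_log hN, cesaroAverage, cesaroAverage, cesaroAverage, ← mul_sub,
    ← Finset.sum_sub_distrib]
  simp only [mul_sub, add_zero]

/-! ### Additive characters -/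

lemma expTwoPiI_add (s t : ℝ) : expTwoPiI (s + t) = expTwoPiI s * expTwoPiI t := by
  rw [expTwoPiI, expTwoPiI, expTwoPiI, ← Complex.exp_add]
  congr 1
  push_cast
  ring

lemma expTwoPiI_natCast_mul (n : ℕ) (t : ℝ) : expTwoPiI (n * t) = expTwoPiI t ^ n := by
  rw [expTwoPiI, expTwoPiI, ← Complex.exp_nat_mul]
  congr 1
  push_cast
  ring

lemma norm_expTwoPiI (t : ℝ) : ‖expTwoPiI t‖ = 1 := by
  rw [expTwoPiI, show (2 * Real.pi * Complex.I * t : ℂ) = ((2 * Real.pi * t : ℝ) : ℂ) * Complex.I by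
    push_cast; ring, Complex.norm_exp_ofReal_mul_I]

lemma expTwoPiI_eq_one_iff (t : ℝ) :
    expTwoPiI t = 1 ↔ t ∈ Set.range (Int.cast : ℤ → ℝ) := by
  rw [expTwoPiI, Complex.exp_eq_one_iff]
  refine exists_congr fun n => ?_
  have h : (2 * Real.pi * Complex.I : ℂ) ≠ 0 := Complex.two_pi_I_ne_zero
  rw [mul_comm (n : ℂ), mul_right_inj' h]
  constructor
  · intro h
    exact_mod_cast h.symm
  · intro h
    exact_mod_cast h.symm

lemma norm_sum_Icc_pow_le {z : ℂ} (hz : ‖z‖ = 1) (hz1 : z ≠ 1) (N : ℕ) :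
    ‖∑ n ∈ Finset.Icc 1 N, z ^ n‖ ≤ 2 / ‖z - 1‖ := by
  have h : ∑ n ∈ Finset.Icc 1 N, z ^ n = z * ((z ^ N - 1) / (z - 1)) := by
    rw [← geom_sum_eq hz1, Finset.mul_sum]
    simp_rw [← pow_succ']
    rw [Finset.range_eq_Ico, Finset.sum_Ico_add' (fun n => z ^ n) 0 N 1]
    rfl
  rw [h, norm_mul, hz, one_mul, norm_div]
  refine div_le_div_of_nonneg_right ?_ (norm_nonneg _)
  refine (norm_sub_le _ _).trans ?_
  rw [norm_pow, hz, one_pow, norm_one]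
  norm_num

/-! ### Irrational frequencies -/

/-- Almost orthogonality: after expanding the square, the diagonal gives at most N/p for each p, and
every off-diagonal pair is a geometric sum with ratio ≠ 1, bounded independently of N. -/
lemma sum_norm_sq_dilate_le {B : Finset ℕ} (hB : ∀ p ∈ B, p.Prime) {ζ : ℕ → ℂ}
    (hζ : ∀ p, ‖ζ p‖ = 1) (hinj : ∀ p ∈ B, ∀ q ∈ B, p ≠ q → ζ p ≠ ζ q) :
    ∃ C : ℝ, 0 ≤ C ∧ ∀ N : ℕ, ∑ n ∈ Finset.Icc 1 N,
      ‖∑ p ∈ B, if p * n ≤ N then ζ p ^ n else 0‖ ^ 2 ≤ N * ∑ p ∈ B, 1 / (p : ℝ) + C := by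
  -- The terms q = p have denominator 0 and count as 0.
  refine ⟨∑ p ∈ B, ∑ q ∈ B, 2 / ‖ζ p * (starRingEnd ℂ) (ζ q) - 1‖,
    Finset.sum_nonneg fun p _ => Finset.sum_nonneg fun q _ => by positivity, fun N => ?_⟩
  have hcast : ((∑ n ∈ Finset.Icc 1 N,
      ‖∑ p ∈ B, if p * n ≤ N then ζ p ^ n else 0‖ ^ 2 : ℝ) : ℂ) =
      ∑ p ∈ B, ∑ q ∈ B, ∑ n ∈ Finset.Icc 1 (min (N / p) (N / q)),
        (ζ p * (starRingEnd ℂ) (ζ q)) ^ n := by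
    push_cast
    simp_rw [← Complex.mul_conj', map_sum, Finset.sum_mul_sum]
    rw [Finset.sum_comm]
    refine Finset.sum_congr rfl fun p hp => ?_
    rw [Finset.sum_comm]
    refine Finset.sum_congr rfl fun q hq => ?_
    have hfil : Finset.Icc 1 (min (N / p) (N / q)) =
        (Finset.Icc 1 N).filter fun n => p * n ≤ N ∧ q * n ≤ N := by
      ext n
      have h1 : n ≤ N / p ↔ p * n ≤ N := by
        rw [Nat.le_div_iff_mul_le (hB p hp).pos, mul_comm]
      have h2 : n ≤ N / q ↔ q * n ≤ N := by
        rw [Nat.le_div_iff_mul_le (hB q hq).pos, mul_comm]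
      simp only [Finset.mem_Icc, Finset.mem_filter, le_min_iff, h1, h2]
      constructor
      · rintro ⟨h3, h4, h5⟩
        exact ⟨⟨h3, (Nat.le_mul_of_pos_left n (hB p hp).pos).trans h4⟩, h4, h5⟩
      · rintro ⟨⟨h3, -⟩, h4, h5⟩
        exact ⟨h3, h4, h5⟩
    rw [hfil, Finset.sum_filter]
    refine Finset.sum_congr rfl fun n _ => ?_
    by_cases h1 : p * n ≤ N <;> by_cases h2 : q * n ≤ N <;> simp [h1, h2, mul_pow]
  have hnn : 0 ≤ ∑ n ∈ Finset.Icc 1 N, ‖∑ p ∈ B, if p * n ≤ N then ζ p ^ n else 0‖ ^ 2 :=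
    Finset.sum_nonneg fun _ _ => by positivity
  rw [← Real.norm_of_nonneg hnn, ← Complex.norm_real, hcast, Finset.mul_sum,
    ← Finset.sum_add_distrib]
  refine norm_sum_le_of_le _ fun p hp => ?_
  have : (N : ℝ) * (1 / p) + ∑ q ∈ B, 2 / ‖ζ p * (starRingEnd ℂ) (ζ q) - 1‖ =
      ∑ q ∈ B, ((if q = p then (N : ℝ) * (1 / p) else 0) +
        2 / ‖ζ p * (starRingEnd ℂ) (ζ q) - 1‖) := by
    rw [Finset.sum_add_distrib, Finset.sum_ite_eq' B p, if_pos hp]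
  rw [this]
  refine norm_sum_le_of_le _ fun q hq => ?_
  have hunit : ‖ζ p * (starRingEnd ℂ) (ζ q)‖ = 1 := by
    rw [norm_mul, RCLike.norm_conj, hζ, hζ, one_mul]
  split_ifs with h
  · subst h
    rw [min_self]
    have h1 : ‖∑ n ∈ Finset.Icc 1 (N / q), (ζ q * (starRingEnd ℂ) (ζ q)) ^ n‖ ≤
        ∑ n ∈ Finset.Icc 1 (N / q), (1 : ℝ) :=
      norm_sum_le_of_le _ fun n _ => by rw [norm_pow, hunit, one_pow]
    have h2 : ∑ n ∈ Finset.Icc 1 (N / q), (1 : ℝ) ≤ N * (1 / q) := by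
      simp only [Finset.sum_const, Nat.card_Icc, add_tsub_cancel_right, nsmul_eq_mul, mul_one]
      rw [mul_one_div]
      exact Nat.cast_div_le
    have h3 : 0 ≤ 2 / ‖ζ q * (starRingEnd ℂ) (ζ q) - 1‖ := by positivity
    linarith
  · rw [zero_add]
    refine norm_sum_Icc_pow_le hunit (fun h1 => hinj p hp q hq (Ne.symm h) ?_) _
    have h2 : (starRingEnd ℂ) (ζ q) * ζ q = 1 := by
      rw [Complex.conj_mul', hζ]; simp
    calc ζ p = ζ p * ((starRingEnd ℂ) (ζ q) * ζ q) := by rw [h2, mul_one]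
      _ = ζ q := by rw [← mul_assoc, h1, one_mul]

lemma exists_finset_primes_sum_one_div_ge (L : ℝ) :
    ∃ B : Finset ℕ, (∀ p ∈ B, p.Prime) ∧ L ≤ ∑ p ∈ B, 1 / (p : ℝ) := by
  have h := not_summable_one_div_on_primes
  rw [not_summable_iff_tendsto_nat_atTop_of_nonneg
    (fun n => Set.indicator_nonneg (fun _ _ => by positivity) n)] at h
  obtain ⟨N, hN⟩ := (h.eventually_ge_atTop L).exists
  refine ⟨(Finset.range N).filter Nat.Prime, fun p hp => (Finset.mem_filter.1 hp).2,
    hN.trans (le_of_eq ?_)⟩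
  rw [Finset.sum_filter]
  refine Finset.sum_congr rfl fun p _ => ?_
  by_cases hp : p.Prime <;> simp [Set.indicator, hp]

/-- Orthogonality of `a (Ω n)` to the characters `n ↦ e(n α)` with `α` irrational. -/
theorem tendsto_cesaroAverage_irrational {a : ℕ → ℂ} {A : ℝ} (ha : ∀ k, ‖a k‖ ≤ A) {α : ℝ}
    (hα : Irrational α) :
    Tendsto (cesaroAverage fun n => expTwoPiI (n * α) * a (Ω n)) atTop (𝓝 0) := by
  have hA : 0 ≤ A := (norm_nonneg _).trans (ha 0)
  rw [Metric.tendsto_atTop]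
  intro ε hε
  obtain ⟨B, hB, hL⟩ := exists_finset_primes_sum_one_div_ge (((2 * A + 1) / ε + 1) ^ 2)
  set L := ∑ p ∈ B, 1 / (p : ℝ) with hLdef
  have hLs : (2 * A + 1) / ε + 1 ≤ √L := Real.le_sqrt_of_sq_le hL
  have hMε : 0 < (2 * A + 1) / ε := by positivity
  have hs0 : 0 < √L := by linarith
  have hL0 : 0 < L := Real.sqrt_pos.1 hs0
  have hLsq : √L * √L = L := Real.mul_self_sqrt hL0.le
  set ζ : ℕ → ℂ := fun p => expTwoPiI (p * α) with hζ
  -- Equality would make (p - q)α an integer, contradicting irrationality.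
  have hζinj : ∀ p ∈ B, ∀ q ∈ B, p ≠ q → ζ p ≠ ζ q := by
    intro p _ q _ hpq h
    have h1 : expTwoPiI ((p - q) * α) * ζ q = ζ q := by
      rw [hζ] at h ⊢
      simp only at h ⊢
      rw [← expTwoPiI_add, ← h]
      congr 1
      ring
    have hq0 : ζ q ≠ 0 := norm_pos_iff.1 (by rw [hζ]; simp only [norm_expTwoPiI]; exact one_pos)
    obtain ⟨k, hk⟩ := (expTwoPiI_eq_one_iff _).1 (mul_eq_right₀ hq0 |>.1 h1)
    have hne : ((p : ℤ) - q) ≠ 0 := sub_ne_zero.2 (by exact_mod_cast hpq)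
    have := hα.intCast_mul hne
    refine this ⟨k, ?_⟩
    push_cast
    rw [hk]
  obtain ⟨C, hC0, hC⟩ := sum_norm_sq_dilate_le hB (fun p => norm_expTwoPiI (p * α)) hζinj
  set F : ℕ → ℂ := fun n => expTwoPiI (n * α) * a (Ω n) with hFdef
  have hF : ∀ n, ‖F n‖ ≤ A := fun n => by
    rw [hFdef]; simp only [norm_mul, norm_expTwoPiI, one_mul]; exact ha _
  -- F(pn) = e(pnα) a(Ω(n) + 1), and the second factor does not depend on p. It is pulled out of the
  -- sum over p and removed by Cauchy–Schwarz.
  have hdil : ∀ N : ℕ, ‖∑ p ∈ B, ∑ n ∈ Finset.Icc 1 (N / p), F (p * n)‖ ≤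
      A * (N * √L + √N * √C) := by
    intro N
    have e : ∑ p ∈ B, ∑ n ∈ Finset.Icc 1 (N / p), F (p * n) = ∑ n ∈ Finset.Icc 1 N,
        a (Ω n + 1) * ∑ p ∈ B, if p * n ≤ N then ζ p ^ n else 0 := by
      simp_rw [Finset.mul_sum]
      rw [Finset.sum_comm]
      refine Finset.sum_congr rfl fun p hp => ?_
      have hfil : Finset.Icc 1 (N / p) = (Finset.Icc 1 N).filter fun n => p * n ≤ N := by
        ext n
        have h1 : n ≤ N / p ↔ p * n ≤ N := by
          rw [Nat.le_div_iff_mul_le (hB p hp).pos, mul_comm]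
        simp only [Finset.mem_Icc, Finset.mem_filter, h1]
        constructor
        · rintro ⟨h3, h4⟩
          exact ⟨⟨h3, (Nat.le_mul_of_pos_left n (hB p hp).pos).trans h4⟩, h4⟩
        · rintro ⟨⟨h3, -⟩, h4⟩
          exact ⟨h3, h4⟩
      rw [hfil, Finset.sum_filter]
      refine Finset.sum_congr rfl fun n hn => ?_
      split_ifs with h
      · have hn0 : n ≠ 0 := by have := (Finset.mem_Icc.1 hn).1; omega
        rw [hFdef, hζ]
        simp only
        rw [ArithmeticFunction.cardFactors_mul (hB p hp).ne_zero hn0,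
          ArithmeticFunction.cardFactors_apply_prime (hB p hp), ← expTwoPiI_natCast_mul,
          mul_comm, add_comm 1]
        congr 2
        push_cast
        ring
      · rw [mul_zero]
    rw [e]
    set D : ℕ → ℂ := fun n => ∑ p ∈ B, if p * n ≤ N then ζ p ^ n else 0 with hD
    have h1 : ‖∑ n ∈ Finset.Icc 1 N, a (Ω n + 1) * D n‖ ≤ A * ∑ n ∈ Finset.Icc 1 N, ‖D n‖ * 1 := by
      rw [Finset.mul_sum]
      refine norm_sum_le_of_le _ fun n _ => ?_
      rw [norm_mul, mul_one]
      exact mul_le_mul_of_nonneg_right (ha _) (norm_nonneg _)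
    refine h1.trans (mul_le_mul_of_nonneg_left ?_ hA)
    refine le_of_sq_le_sq ?_ (by positivity)
    refine (Finset.sum_mul_sq_le_sq_mul_sq _ _ _).trans ?_
    have h3 : ∑ n ∈ Finset.Icc 1 N, (1 : ℝ) ^ 2 = N := by simp
    rw [h3]
    have h4 := mul_le_mul_of_nonneg_right (hC N) (Nat.cast_nonneg (α := ℝ) N)
    refine h4.trans ?_
    have s1 : √L ^ 2 = L := Real.sq_sqrt hL0.le
    have s2 : √(N : ℝ) ^ 2 = N := Real.sq_sqrt (Nat.cast_nonneg N)
    have s3 : √C ^ 2 = C := Real.sq_sqrt hC0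
    have h5 : 0 ≤ N * √L * (√N * √C) := by positivity
    have h7 : (N * √L + √N * √C) ^ 2 = N ^ 2 * (√L ^ 2) + 2 * (N * √L * (√N * √C))
      + √(N : ℝ) ^ 2 * √C ^ 2 := by ring
    rw [h7, s1, s2, s3]
    nlinarith
  have htot : ∀ N : ℕ, L * ‖∑ n ∈ Finset.Icc 1 N, F n‖ ≤
      2 * A * √L * N + A * (√C + 2 * B.card) * √N := by
    intro N
    have h1 := norm_sum_dilate_sub_le hB (c := fun _ => 1) (fun _ => ⟨zero_le_one, le_rfl⟩) hF N
    simp only [Complex.ofReal_one, one_mul] at h1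
    rw [← hLdef] at h1
    have h2 := norm_le_norm_add_norm_sub (∑ p ∈ B, ∑ n ∈ Finset.Icc 1 (N / p), F (p * n))
      ((L : ℂ) * ∑ n ∈ Finset.Icc 1 N, F n)
    rw [norm_mul, Complex.norm_real, Real.norm_of_nonneg hL0.le] at h2
    have h3 := hdil N
    linarith
  have hlim : Tendsto (fun N : ℕ => A * (√C + 2 * B.card) / √(N : ℝ)) atTop (𝓝 0) :=
    Tendsto.const_div_atTop (Real.tendsto_sqrt_atTop.comp tendsto_natCast_atTop_atTop) _
  obtain ⟨N₀, hN₀⟩ := eventually_atTop.1 (hlim.eventually (gt_mem_nhds one_pos))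
  refine ⟨max N₀ 1, fun N hN => ?_⟩
  have hN1 : (0 : ℝ) < N := by exact_mod_cast (le_max_right _ _).trans hN
  have hb := hN₀ N ((le_max_left _ _).trans hN)
  have hsN : 0 < √(N : ℝ) := Real.sqrt_pos.2 hN1
  rw [div_lt_one hsN] at hb
  have hNN : √(N : ℝ) * √N = N := Real.mul_self_sqrt hN1.le
  rw [dist_zero_right, cesaroAverage, norm_mul, norm_div, norm_one, Complex.norm_natCast,
    one_div_mul_eq_div, div_lt_iff₀ hN1]
  set x := ‖∑ n ∈ Finset.Icc 1 N, F n‖ with hx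
  have h1 : L * x ≤ (2 * A * √L + 1) * N := by
    have := mul_le_mul_of_nonneg_right hb.le hsN.le
    rw [hNN] at this
    have := htot N
    linarith
  have hs1 : 1 ≤ √L := by linarith
  have h2 : √L * x ≤ (2 * A + 1) * N := by
    refine le_of_mul_le_mul_left ?_ hs0
    rw [← mul_assoc, hLsq]
    nlinarith
  have h3 : 2 * A + 1 < ε * √L := by
    rw [← div_lt_iff₀' hε]
    linarith
  have h4 := mul_lt_mul_of_pos_right h3 hN1
  refine lt_of_mul_lt_mul_left ?_ hs0.le
  linarith

/-! ### Averages along arithmetic progressions -/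

lemma sum_range_filter_mod (D : ℕ → ℂ) {m r : ℕ} (hr : r < m) (N : ℕ) :
    ∑ k ∈ Finset.range N, (if k % m = r then D k else 0) =
      ∑ n ∈ Finset.range ((N + (m - 1 - r)) / m), D (m * n + r) := by
  have hm : 0 < m := by omega
  rw [← Finset.sum_filter]
  symm
  -- The quotient is ⌈(N - r)/m⌉, the number of n ≥ 0 with mn + r < N.
  have hlt : ∀ n, n < (N + (m - 1 - r)) / m ↔ m * n + r < N := by
    intro n
    rw [Nat.lt_iff_add_one_le, Nat.le_div_iff_mul_le hm, add_mul, mul_comm n m]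
    omega
  refine Finset.sum_nbij' (fun n => m * n + r) (fun k => k / m) ?_ ?_ ?_ ?_ ?_
  · intro n hn
    simp only [Finset.mem_range, Finset.mem_filter] at hn ⊢
    exact ⟨(hlt n).1 hn, by rw [Nat.mul_add_mod, Nat.mod_eq_of_lt hr]⟩
  · intro k hk
    simp only [Finset.mem_range, Finset.mem_filter] at hk ⊢
    rw [hlt, ← hk.2, Nat.div_add_mod]
    exact hk.1
  · intro n _
    rw [Nat.mul_add_div hm, Nat.div_eq_of_lt hr, add_zero]
  · intro k hk
    simp only [Finset.mem_filter] at hk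
    rw [← hk.2, Nat.div_add_mod]
  · intro n _
    rfl

/-- Residue classes fit [0, N) better than [1, N]; the two sums differ only by the terms at 0 and N.
-/
lemma tendsto_cesaroAverage_iff_range {g : ℕ → ℂ} {A : ℝ} (hg : ∀ n, ‖g n‖ ≤ A) (l : ℂ) :
    Tendsto (cesaroAverage g) atTop (𝓝 l) ↔
      Tendsto (fun N : ℕ => (1 / (N : ℂ)) * ∑ n ∈ Finset.range N, g n) atTop (𝓝 l) := by
  have hdiff : Tendsto (fun N : ℕ => cesaroAverage g N -
      (1 / (N : ℂ)) * ∑ n ∈ Finset.range N, g n) atTop (𝓝 0) := by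
    refine squeeze_zero_norm (a := fun N : ℕ => 2 * A / N) (fun N => ?_)
      (tendsto_const_div_atTop_nhds_zero_nat _)
    have e : ∑ n ∈ Finset.Icc 1 N, g n = ∑ n ∈ Finset.range N, g n + (g N - g 0) := by
      have h1 := Finset.sum_range_succ g N
      have h2 := Finset.sum_range_succ' g N
      have h3 : ∑ n ∈ Finset.Icc 1 N, g n = ∑ n ∈ Finset.range N, g (n + 1) := by
        rw [Finset.range_eq_Ico, Finset.sum_Ico_add' g 0 N 1]
        rfl
      rw [h3]
      linear_combination h1 - h2
    rw [cesaroAverage, e, ← mul_sub, add_sub_cancel_left, norm_mul, norm_div, norm_one,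
      Complex.norm_natCast, one_div_mul_eq_div]
    refine div_le_div_of_nonneg_right ((norm_sub_le _ _).trans ?_) (Nat.cast_nonneg N)
    linarith [hg N, hg 0]
  constructor
  · intro h
    simpa using h.sub hdiff
  · intro h
    simpa using h.add hdiff

/-- Sampling at mN, the interval [0, mN) contains exactly N members of the class, so multiplying by
m restores the normalisation. -/
lemma tendsto_cesaroAverage_progression {D : ℕ → ℂ} {A : ℝ} (hD : ∀ n, ‖D n‖ ≤ A) {m r : ℕ}
    (hr : r < m)
    (h : Tendsto (cesaroAverage fun k => (if k % m = r then 1 else 0) * D k) atTop (𝓝 0)) :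
    Tendsto (cesaroAverage fun n => D (m * n + r)) atTop (𝓝 0) := by
  have hA : 0 ≤ A := (norm_nonneg _).trans (hD 0)
  have hm : 0 < m := by omega
  rw [tendsto_cesaroAverage_iff_range (A := A) fun n => hD _]
  rw [tendsto_cesaroAverage_iff_range (A := A) fun n => by
    split_ifs
    · simpa using hD n
    · simpa using hA] at h
  have hmt : Tendsto (fun N : ℕ => m * N) atTop atTop :=
    tendsto_id.const_mul_atTop' hm
  have h1 := (h.comp hmt).const_mul (m : ℂ)
  rw [mul_zero] at h1
  refine h1.congr fun N => ?_
  simp only [Function.comp_apply, ite_mul, one_mul, zero_mul]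
  rw [sum_range_filter_mod D hr, ← mul_assoc]
  have e : (m * N + (m - 1 - r)) / m = N := by
    rw [Nat.mul_add_div hm, Nat.div_eq_of_lt (by omega), add_zero]
  rw [e]
  congr 1
  have : (m : ℂ) ≠ 0 := by exact_mod_cast hm.ne'
  rw [Nat.cast_mul]
  field_simp

lemma tendsto_cesaroAverage_of_progressions {D : ℕ → ℂ} {A : ℝ} (hD : ∀ n, ‖D n‖ ≤ A) {m : ℕ}
    (hm : 0 < m) {l : ℕ → ℂ}
    (h : ∀ r < m, Tendsto (cesaroAverage fun n => D (m * n + r)) atTop (𝓝 (l r))) :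
    Tendsto (cesaroAverage D) atTop (𝓝 ((1 / (m : ℂ)) * ∑ r ∈ Finset.range m, l r)) := by
  rw [tendsto_cesaroAverage_iff_range hD]
  have hmC : (m : ℂ) ≠ 0 := by exact_mod_cast hm.ne'
  have hlim : ∀ r ∈ Finset.range m, Tendsto (fun N : ℕ => (1 / (N : ℂ)) *
      ∑ k ∈ Finset.range N, (if k % m = r then D k else 0)) atTop (𝓝 ((1 / (m : ℂ)) * l r)) := by
    intro r hr
    have hr := Finset.mem_range.1 hr
    -- The number of members of the class r below N; `h2` records that its density is 1/m.
    set b : ℕ → ℕ := fun N => (N + (m - 1 - r)) / m with hb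
    have hbt : Tendsto b atTop atTop :=
      (Nat.tendsto_div_const_atTop hm.ne').comp (tendsto_add_atTop_nat _)
    have h1 := ((tendsto_cesaroAverage_iff_range (fun n => hD _) _).1 (h r hr)).comp hbt
    have h2 : Tendsto (fun N : ℕ => (b N : ℂ) / N) atTop (𝓝 (1 / (m : ℂ))) := by
      have hd : Tendsto (fun N : ℕ => (b N : ℂ) / N - 1 / (m : ℂ)) atTop (𝓝 0) := by
        refine squeeze_zero_norm' (a := fun N : ℕ => 1 / (N : ℝ)) ?_
          (tendsto_const_div_atTop_nhds_zero_nat _)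
        filter_upwards [eventually_gt_atTop 0] with N hN
        have hN' : (0 : ℝ) < N := by exact_mod_cast hN
        have hm' : (0 : ℝ) < m := by exact_mod_cast hm
        have e : (b N : ℂ) / N - 1 / (m : ℂ) = (((b N : ℝ) * m - N) / (N * m) : ℝ) := by
          have hNC : (N : ℂ) ≠ 0 := by exact_mod_cast hN.ne'
          push_cast
          field_simp
        rw [e, Complex.norm_real, Real.norm_eq_abs, abs_div, abs_of_pos (mul_pos hN' hm'),
          div_le_div_iff₀ (mul_pos hN' hm') hN']
        have h3 : b N * m ≤ N + (m - 1 - r) := Nat.div_mul_le_self _ _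
        have h4 : N + (m - 1 - r) < b N * m + m := Nat.lt_div_mul_add hm
        have h5 : b N * m ≤ N + m := by omega
        have h6 : N ≤ b N * m + m := by omega
        have h7 : |(b N : ℝ) * m - N| ≤ m := by
          rw [abs_le]
          constructor
          · have : (N : ℝ) ≤ b N * m + m := by exact_mod_cast h6
            linarith
          · have : (b N : ℝ) * m ≤ N + m := by exact_mod_cast h5
            linarith
        nlinarith
      simpa using hd.add_const (1 / (m : ℂ))
    refine (h2.mul h1).congr' ?_
    filter_upwards [hbt.eventually_gt_atTop 0] with N hN
    simp only [Function.comp_apply]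
    rw [sum_range_filter_mod D hr, ← mul_assoc]
    congr 1
    have : (b N : ℂ) ≠ 0 := by exact_mod_cast hN.ne'
    field_simp
  have hsum := tendsto_finsetSum _ hlim
  rw [← Finset.mul_sum] at hsum
  refine hsum.congr fun N => ?_
  rw [← Finset.mul_sum, Finset.sum_comm]
  congr 1
  refine Finset.sum_congr rfl fun k _ => ?_
  rw [Finset.sum_ite_eq (Finset.range m) (k % m), if_pos (Finset.mem_range.2 (Nat.mod_lt k hm))]

/-- The indicator of k ≡ r mod m is a weight invariant under multiplication by primes p ≡ 1 mod m,
whether or not r is coprime to m. -/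
theorem tendsto_cesaroAverage_Omega_progression {a : ℕ → ℂ} {A : ℝ} (ha : ∀ k, ‖a k‖ ≤ A)
    {m r : ℕ} (hr : r < m) :
    Tendsto (cesaroAverage fun n => a (Ω (m * n + r)) - a (Ω (m * n + r) + 1)) atTop (𝓝 0) := by
  have hA : 0 ≤ A := (norm_nonneg _).trans (ha 0)
  have : NeZero m := ⟨by omega⟩
  refine tendsto_cesaroAverage_progression (D := fun k => a (Ω k) - a (Ω k + 1)) (A := A + A)
    (fun n => (norm_sub_le _ _).trans (add_le_add (ha _) (ha _))) hr ?_
  refine tendsto_cesaroAverage_shift_Omega m (W := 1) ha (fun n => by split_ifs <;> simp) ?_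
  intro p _ hp n
  have h1 : p * n % m = n % m := by
    rw [← Nat.ModEq, ← ZMod.natCast_eq_natCast_iff, Nat.cast_mul, hp, one_mul]
  rw [h1]

/-! ### Unique ergodicity -/

/-- The uniform probability measure on `y 1, …, y (N + 1)`. -/
noncomputable def empiricalMeasure {X : Type*} [MeasurableSpace X] (y : ℕ → X) (N : ℕ) :
    Measure X :=
  (ENNReal.ofReal (1 / ((N + 1 : ℕ) : ℝ))) • ∑ n ∈ Finset.Icc 1 (N + 1), Measure.dirac (y n)

instance {X : Type*} [MeasurableSpace X] (y : ℕ → X) (N : ℕ) :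
    IsProbabilityMeasure (empiricalMeasure y N) := by
  constructor
  rw [empiricalMeasure, Measure.smul_apply, Measure.finsetSum_apply]
  simp only [measure_univ, Finset.sum_const, Nat.card_Icc, add_tsub_cancel_right, nsmul_eq_mul,
    mul_one, smul_eq_mul]
  rw [← ENNReal.ofReal_natCast, ← ENNReal.ofReal_mul (by positivity),
    one_div_mul_cancel (by positivity), ENNReal.ofReal_one]

lemma integral_empiricalMeasure {X : Type*} [TopologicalSpace X] [MeasurableSpace X]
    [OpensMeasurableSpace X] (y : ℕ → X) (N : ℕ) {f : X → ℂ} (hf : Continuous f) :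
    ∫ z, f z ∂(empiricalMeasure y N) = cesaroAverage (fun n => f (y n)) (N + 1) := by
  have hm := hf.stronglyMeasurable
  rw [empiricalMeasure, integral_smul_measure, integral_finsetSum_measure, cesaroAverage,
    ENNReal.toReal_ofReal (by positivity), Complex.real_smul]
  · push_cast
    congr 1
    refine Finset.sum_congr rfl fun n _ => ?_
    exact integral_dirac' _ _ hm
  · intro n _
    exact integrable_dirac' hm (by simp)

/-- Probability measures on a compact metric space form a compact space. The hypothesis on y makes
every cluster point of the empirical measures T-invariant, hence equal to μ, and a unique cluster
point in a compact space is a limit. -/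
theorem UniquelyErgodic.tendsto_cesaroAverage {X : Type*} [MetricSpace X] [CompactSpace X]
    [MeasurableSpace X] [BorelSpace X] {T : X → X} (hT : Continuous T) (hue : UniquelyErgodic T)
    {μ : Measure X} (hμ : IsProbabilityMeasure μ) (hinv : MeasurePreserving T μ μ) {y : ℕ → X}
    (hy : ∀ f : C(X, ℂ), Tendsto (cesaroAverage fun n => f (y n) - f (T (y n))) atTop (𝓝 0))
    (f : C(X, ℂ)) : Tendsto (cesaroAverage fun n => f (y n)) atTop (𝓝 (∫ z, f z ∂μ)) := by
  set P : ℕ → ProbabilityMeasure X := fun N => ⟨empiricalMeasure y N, inferInstance⟩ with hP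
  have hPint : ∀ (N : ℕ) (f : X → ℂ), Continuous f →
      ∫ z, f z ∂(P N : Measure X) = cesaroAverage (fun n => f (y n)) (N + 1) :=
    fun N f hf => integral_empiricalMeasure y N hf
  have hlim : Tendsto P atTop (𝓝 ⟨μ, hμ⟩) := by
    refine le_nhds_of_unique_clusterPt fun ν hν => ?_
    have hνT : Measure.map T (ν : Measure X) = ν := by
      have : IsProbabilityMeasure (Measure.map T (ν : Measure X)) :=
        Measure.isProbabilityMeasure_map hT.aemeasurable
      refine ext_of_forall_integral_eq_of_IsFiniteMeasure fun g => ?_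
      rw [integral_map hT.aemeasurable g.continuous.aestronglyMeasurable]
      set gc : C(X, ℂ) := ⟨fun z => (g z : ℂ), by fun_prop⟩ with hgc
      -- The defect of invariance tested on g: weakly continuous and tending to 0 along `P`, so zero
      -- at every cluster point.
      set Φ : ProbabilityMeasure X → ℝ := fun ν =>
        (∫ z, g z ∂(ν : Measure X)) - ∫ z, g (T z) ∂(ν : Measure X) with hΦ
      have hΦc : Continuous Φ := by
        refine Continuous.sub ?_ ?_
        · exact ProbabilityMeasure.continuous_integral_boundedContinuousFunction g
        · exact ProbabilityMeasure.continuous_integral_boundedContinuousFunction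
            (g.compContinuous ⟨T, hT⟩)
      have h0 : Tendsto (fun N => Φ (P N)) atTop (𝓝 0) := by
        have h1 := (hy gc).comp (tendsto_add_atTop_nat 1)
        have h2 := (Complex.continuous_re.tendsto 0).comp h1
        rw [Complex.zero_re] at h2
        refine h2.congr fun N => ?_
        have e1 := hPint N (fun z => (g z : ℂ)) (by fun_prop)
        have e2 := hPint N (fun z => (g (T z) : ℂ)) (by fun_prop)
        rw [integral_complex_ofReal] at e1 e2
        simp only [Function.comp_apply, hΦ]
        have e3 : cesaroAverage (fun n => gc (y n) - gc (T (y n))) (N + 1) =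
            cesaroAverage (fun n => (g (y n) : ℂ)) (N + 1) -
              cesaroAverage (fun n => (g (T (y n)) : ℂ)) (N + 1) := by
          rw [cesaroAverage, cesaroAverage, cesaroAverage, ← mul_sub, ← Finset.sum_sub_distrib]
          rfl
        rw [e3, ← e1, ← e2, ← Complex.ofReal_sub, Complex.ofReal_re]
      have h3 : ClusterPt (Φ ν) (map Φ (map P atTop)) :=
        hν.map hΦc.continuousAt tendsto_map
      rw [map_map] at h3
      have h4 : ClusterPt (Φ ν) (𝓝 0) := h3.mono h0
      have h5 : Φ ν = 0 := by
        have : (𝓝 (Φ ν) ⊓ 𝓝 0).NeBot := h4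
        exact eq_of_nhds_neBot this
      simp only [hΦ] at h5
      linarith
    apply Subtype.ext
    exact hue.unique ⟨ν.2, ⟨hT.measurable, hνT⟩⟩ ⟨hμ, hinv⟩
  have h := (ProbabilityMeasure.tendsto_iff_forall_integral_rclike_tendsto ℂ).1 hlim
    (BoundedContinuousFunction.mkOfCompact f)
  rw [← tendsto_add_atTop_iff_nat 1]
  refine h.congr fun N => ?_
  exact hPint N f f.continuous

/-- With a(k) = g(T^k x), raising Ω by one is applying T, so insensitivity to the shift is precisely
asymptotic invariance. -/
theorem UniquelyErgodic.tendsto_progression {X : Type*} [MetricSpace X] [CompactSpace X]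
    [MeasurableSpace X] [BorelSpace X] {T : X → X} (hT : Continuous T) (hue : UniquelyErgodic T)
    {μ : Measure X} (hμ : IsProbabilityMeasure μ) (hinv : MeasurePreserving T μ μ)
    (f : C(X, ℂ)) (x : X) {m r : ℕ} (hr : r < m) :
    Tendsto (cesaroAverage fun n => f (T^[Ω (m * n + r)] x)) atTop (𝓝 (∫ y, f y ∂μ)) := by
  refine hue.tendsto_cesaroAverage hT hμ hinv (y := fun n => T^[Ω (m * n + r)] x)
    (fun g => ?_) f
  have h := tendsto_cesaroAverage_Omega_progression (a := fun k => g (T^[k] x)) (A := ‖g‖)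
    (fun k => g.norm_coe_le_norm _) hr
  simpa only [Function.iterate_succ_apply'] using h

/-! ### Rational frequencies and the main theorem -/

lemma expTwoPiI_pow_den (α : ℚ) : expTwoPiI α ^ α.den = 1 := by
  rw [← expTwoPiI_natCast_mul, expTwoPiI_eq_one_iff]
  refine ⟨α.num, ?_⟩
  have := Rat.den_mul_eq_num α
  exact_mod_cast this.symm

theorem mainTheorem5 :
    (∀ (X : Type*) [MetricSpace X] [CompactSpace X] [MeasurableSpace X] [BorelSpace X]
        (T : X → X) (_hT : Continuous T) (_hue : UniquelyErgodic T)
        (μ : Measure X) (_hμ : IsProbabilityMeasure μ) (_hinv : MeasurePreserving T μ μ)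
        (f : C(X, ℂ)) (x : X),
      (∀ α : ℝ,
        (α ∈ Set.range (Int.cast : ℤ → ℝ) →
          Tendsto (cesaroAverage fun n => expTwoPiI (n * α) * f (T^[Ω n] x)) atTop
            (𝓝 (∫ y, f y ∂μ))) ∧
        (α ∉ Set.range (Int.cast : ℤ → ℝ) →
          Tendsto (cesaroAverage fun n => expTwoPiI (n * α) * f (T^[Ω n] x)) atTop
            (𝓝 0))) ∧
      (∀ m r : ℕ, 1 ≤ m → r < m →
        Tendsto (cesaroAverage fun n => f (T^[Ω (m * n + r)] x)) atTop
          (𝓝 (∫ y, f y ∂μ)))) ∧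
    (∀ α : ℚ,
      Tendsto (cesaroAverage fun n =>
        expTwoPiI (n * (α : ℝ)) * (ArithmeticFunction.liouville n : ℂ)) atTop (𝓝 0)) := by
  refine ⟨?_, ?_⟩
  · intro X _ _ _ _ T hT hue μ hμ hinv f x
    refine ⟨fun α => ⟨fun hα => ?_, fun hα => ?_⟩, fun m r _ hr =>
      hue.tendsto_progression hT hμ hinv f x hr⟩
    · have h := hue.tendsto_progression hT hμ hinv f x one_pos
      simp only [one_mul, add_zero] at h
      have h1 : expTwoPiI α = 1 := (expTwoPiI_eq_one_iff α).2 hα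
      simpa only [expTwoPiI_natCast_mul, h1, one_pow, one_mul] using h
    · by_cases hirr : Irrational α
      · exact tendsto_cesaroAverage_irrational (a := fun k => f (T^[k] x)) (A := ‖f‖)
          (fun k => f.norm_coe_le_norm _) hirr
      · obtain ⟨β, rfl⟩ : ∃ β : ℚ, (β : ℝ) = α := by
          simpa [Irrational] using hirr
        set z := expTwoPiI β with hz
        have hz1 : z ≠ 1 := fun h => hα ((expTwoPiI_eq_one_iff _).1 h)
        have hzd : z ^ β.den = 1 := expTwoPiI_pow_den β
        simp only [expTwoPiI_natCast_mul, ← hz]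
        -- On the class of r modulo the denominator the character is the constant z^r. All classes
        -- share the same limit ∫ f dμ, and the sum of the z^r over a full period vanishes.
        have h := tendsto_cesaroAverage_of_progressions (D := fun n => z ^ n * f (T^[Ω n] x))
          (A := ‖f‖) (fun n => by
            rw [norm_mul, norm_pow, hz, norm_expTwoPiI, one_pow, one_mul]
            exact f.norm_coe_le_norm _) β.den_pos (l := fun r => z ^ r * ∫ y, f y ∂μ) ?_
        · rwa [← Finset.sum_mul, geom_sum_eq hz1, hzd, sub_self, zero_div, zero_mul,
            mul_zero] at h
        · intro r hr
          have h1 := (hue.tendsto_progression hT hμ hinv f x hr).const_mul (z ^ r)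
          refine h1.congr fun N => ?_
          rw [cesaroAverage, cesaroAverage, mul_left_comm, Finset.mul_sum]
          congr 1
          refine Finset.sum_congr rfl fun n _ => ?_
          rw [pow_add, pow_mul, hzd, one_pow, one_mul]
  · intro α
    have : NeZero α.den := ⟨α.den_pos.ne'⟩
    set z := expTwoPiI α with hz
    have hzd : z ^ α.den = 1 := expTwoPiI_pow_den α
    -- For a(k) = (-1)^k the shift changes the sign, so a(k) - a(k + 1) = 2a(k); this is the origin
    -- of the factor 1/2 below. The weight z^n has period `α.den`, hence is invariant under p ≡ 1.
    have h := tendsto_cesaroAverage_shift_Omega α.den (w := fun n => z ^ n)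
      (a := fun k => (-1 : ℂ) ^ k) (A := 1) (W := 1) (fun k => by simp)
      (fun n => by rw [norm_pow, hz, norm_expTwoPiI, one_pow]) (fun p _ hp n => by
        have h1 : p * n ≡ n [MOD α.den] := by
          rw [← ZMod.natCast_eq_natCast_iff, Nat.cast_mul, hp, one_mul]
        exact pow_eq_pow_of_modEq h1 hzd)
    have h2 := h.const_mul (1 / 2 : ℂ)
    rw [mul_zero] at h2
    refine h2.congr fun N => ?_
    rw [cesaroAverage, cesaroAverage, mul_left_comm, Finset.mul_sum]
    congr 1
    refine Finset.sum_congr rfl fun n hn => ?_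
    have hn0 : n ≠ 0 := by have := (Finset.mem_Icc.1 hn).1; omega
    rw [ArithmeticFunction.liouville_apply hn0, expTwoPiI_natCast_mul, ← hz]
    push_cast
    ring
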